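/- **Conventions.** A *sober lattice* is a sober ($T_0$) topological space $L$ whose specialization order ($x\le y$ iff $x\in\overline{\{y\}}$) has a least element $0$ and binary joins, the join $\vee:L\times L\to L$ being continuous; its order is then a complete lattice, with top $1_L$. Homomorphisms of sober lattices are the continuous maps preserving $0$ and $\vee$. A *measurement space* is a sober lattice $M$ with a continuous associative product and a continuous involution such that $m0=0$, $m(n\vee n')=mn\vee mn'$, $m^{**}=m$, $(mn)^*=n^*m^*$, and $mm^*m\le m\Rightarrow m\le mm^*m$; homomorphisms of measurement spaces are the homomorphisms of sober lattices that preserve products and involution. A measurement space $M$ is *classical* if, as a lattice, it is a countably based locally compact locale (distributive continuous lattice), its topology is the Scott topology, and $m\le mm^*m$ for all $m$. An *inverse quantal frame* is a unital stably Gelfand involutive quantale $Q$ (unit $e$) that is also a locale and satisfies $1=\bigvee\mathcal I(Q)$, where $\mathcal I(Q)=\{s: ss^*\le e,\ s^*s\le e\}$. For measurement spaces $M$ and $\mathcal O$, an *observer map* $p:M\to\mathcal O$ is a pair $p=(\iota,\rho)$ of a homomorphism of measurement spaces $\iota:\mathcal O\to M$ and a homomorphism of sober lattices $\rho:M\to\mathcal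 O$ such that $\rho(\iota(\omega))=\omega$, $\rho(m^*)=\rho(m)^*$ and $\rho(m\,\iota(\omega))=\rho(m)\,\omega$ for all $m\in M$, $\omega\in\mathcal O$; the pair $(\mathcal O,p)$ is called an *observer* of $M$. It is * *étale* if $\mathcal O$ is a classical measurement space and an inverse quantal frame, and $\rho(m)\,\omega\,\rho(n)\le\rho(m\,\iota(\omega)\,n)$ for all $\omega\in\mathcal O$ and all $m,n\in M$ with $\rho(m),\rho(n)\in\mathcal I(\mathcal O)$; * *full* if $\iota(1_{\mathcal O})=1_M$; * *multiplicative* if $\rho(mn)\le\rho(m)\rho(n)$ for all $m,n\in M$. For a C\*-algebra $A$, $\operatorname{Max}A$ is the set of closed linear subspaces of $A$ with the lower Vietoris topology (generated by the sets $\{P: P\cap U\ne\emptyset\}$, $U\subset A$ open), the product $PQ=\overline{\operatorname{span}}\{ab: a\in P,\ b\in Q\}$ and the pointwise involution; its order is inclusion. Let $G$ be an étale topological groupoid (domain map $d:G_1\to G_0$ a local homeomorphism, range map $r$) whose arrow space $G_1$ is Hausdorff, locally compact and second-countable. Let $\mathcal O(G)$ be the topology of $G_1$, ordered by inclusion, with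 the Scott topology, the product $UV=\{yz: y\in U,\ z\in V,\ d(y)=r(z)\}$ and the involution $U^*=\{x^{-1}:x\in U\}$. Let $C_c(G)$ be the convolution $*$-algebra of compactly supported continuous functions $G_1\to\mathbb C$, with $(f*g)(x)=\sum_{x=yz}f(y)g(z)$ and $f^*(x)=\overline{f(x^{-1})}$, and let $C_r^*(G)$ be its completion in the reduced norm, that is, the norm of the representation of $C_c(G)$ on $\ell^2(G_1)=\bigoplus_{x\in G_0}\ell^2(d^{-1}(x))$ by left convolution. Elements of $C_r^*(G)$ are regarded as continuous functions on $G_1$, through the continuous extension of the inclusion of $C_c(G)$ into the bounded functions. For an open set $U\subset G_1$ let $C_c(U)=\{f\in C_c(G):\operatorname{supp}f\subset U\}$ and let $\overline{C_c(U)}$ be its closure in $C_r^*(G)$; for $V\in\operatorname{Max}C_r^*(G)$ let $\operatorname{osupp}V=\bigcup_{f\in V}\{x\in G_1: f(x)\ne 0\}$. **Theorem.** Let $G$ be a second-countable locally compact Hausdorff étale groupoid. Then the pair $p=\bigl(U\mapsto\overline{C_c(U)},\ V\mapsto\operatorname{osupp}V\bigr)$ is an observer map $$p:\operatorname{Max}C_r^*(G)\to\mathcal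 O(G)$$ (in particular, both sides are measurement spaces), and the observer $(\mathcal O(G),p)$ is étale, full and multiplicative. -/

import Mathlib

open Set Topology Function

section FibreSum

variable {E X : Type*} [TopologicalSpace E] [TopologicalSpace X]

/-- The sum of `F` over the fibres of `p`. -/
noncomputable def fibreSum (p : E → X) (F : E → ℂ) (x : X) : ℂ := ∑ᶠ e : p ⁻¹' {x}, F e

theorem exists_fibre_bound {p : E → X} (hp : IsLocalHomeomorph p) {K : Set E} (hK : IsCompact K) :
    ∃ n : ℕ, ∀ x, (K ∩ p ⁻¹' {x}).encard ≤ n := by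
  refine hK.induction_on (p := fun K => ∃ n : ℕ, ∀ x, (K ∩ p ⁻¹' {x}).encard ≤ n)
    ⟨0, by simp⟩ ?_ ?_ ?_
  · rintro s t hst ⟨n, hn⟩
    exact ⟨n, fun x => (encard_le_encard (inter_subset_inter_left _ hst)).trans (hn x)⟩
  · rintro s t ⟨n, hn⟩ ⟨m, hm⟩
    refine ⟨n + m, fun x => ?_⟩
    rw [union_inter_distrib_right]
    refine (encard_union_le _ _).trans ?_
    push_cast
    exact add_le_add (hn x) (hm x)
  · intro x _
    obtain ⟨e, hx, he⟩ := hp x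
    refine ⟨e.source, mem_nhdsWithin_of_mem_nhds (e.open_source.mem_nhds hx), 1, fun y => ?_⟩
    rw [Nat.cast_one, encard_le_one_iff]
    rintro a b ⟨ha, ha'⟩ ⟨hb, hb'⟩
    refine e.injOn ha hb ?_
    rw [← he]
    exact ha'.trans hb'.symm

theorem finite_fibre_support {p : E → X} (hp : IsLocalHomeomorph p) {F : E → ℂ}
    (hF : HasCompactSupport F) (x : X) : (support fun e : p ⁻¹' {x} => F e).Finite := by
  obtain ⟨n, hn⟩ := exists_fibre_bound hp hF
  have h1 : (tsupport F ∩ p ⁻¹' {x}).Finite :=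
    encard_lt_top_iff.1 ((hn x).trans_lt (ENat.natCast_lt_top n))
  refine Finite.of_finite_image (f := Subtype.val) (h1.subset ?_) Subtype.val_injective.injOn
  rintro _ ⟨e, he, rfl⟩
  exact ⟨subset_tsupport F he, e.2⟩

theorem continuous_fibreSum_of_subset [T2Space X] {p : E → X} (e : OpenPartialHomeomorph E X)
    (he : p = e) {F : E → ℂ} (hF : Continuous F) (hF' : HasCompactSupport F)
    (hs : tsupport F ⊆ e.source) (hp : Continuous p) : Continuous (fibreSum p F) := by
  have h1 : ∀ x ∈ e.target, fibreSum p F x = F (e.symm x) := by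
    intro x hx
    have hpe : p (e.symm x) = x := by rw [he]; exact e.right_inv hx
    rw [fibreSum, finsum_eq_single _ (⟨e.symm x, hpe⟩ : p ⁻¹' {x})]
    rintro ⟨b, hb⟩ hne
    by_contra h0
    have hb1 : b ∈ e.source := hs (subset_tsupport F h0)
    apply hne
    ext
    change b = e.symm x
    have hb : p b = x := hb
    rw [← hb, he, e.left_inv hb1]
  have h2 : ∀ x, x ∉ p '' tsupport F → fibreSum p F x = 0 := by
    intro x hx
    refine finsum_eq_zero_of_forall_eq_zero ?_
    rintro ⟨b, hb⟩
    by_contra h0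
    exact hx ⟨b, subset_tsupport F h0, hb⟩
  have hc : IsClosed (p '' tsupport F) := (hF'.isCompact.image hp).isClosed
  refine continuous_iff_continuousAt.2 fun x => ?_
  by_cases hx : x ∈ e.target
  · have : ContinuousAt (fun x => F (e.symm x)) x :=
      hF.continuousAt.comp (e.continuousAt_symm hx)
    refine this.congr ?_
    filter_upwards [e.open_target.mem_nhds hx] with y hy using (h1 y hy).symm
  · have hx' : x ∉ p '' tsupport F := by
      rintro ⟨b, hb, rfl⟩
      apply hx
      rw [he]
      exact e.map_source (hs hb)
    refine (continuousAt_const (y := (0 : ℂ))).congr ?_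
    filter_upwards [hc.isOpen_compl.mem_nhds hx'] with y hy using (h2 y hy).symm

theorem continuous_fibreSum [T2Space X] [T2Space E] [LocallyCompactSpace E] {p : E → X}
    (hp : IsLocalHomeomorph p) {F : E → ℂ} (hF : Continuous F) (hF' : HasCompactSupport F) :
    Continuous (fibreSum p F) := by
  choose e he hpe using id hp
  obtain ⟨t, ht⟩ := hF'.isCompact.elim_finite_subcover (fun x => (e x).source)
    (fun x => (e x).open_source) (fun x _ => mem_iUnion.2 ⟨x, he x⟩)
  let φ := t.equivFin
  obtain ⟨ψ, h1, h2, -, -⟩ := exists_continuous_sum_one_of_isOpen_isCompact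
    (s := fun i => (e (φ.symm i)).source) (fun i => (e _).open_source) hF'.isCompact (by
      intro x hx
      obtain ⟨y, hy, hxy⟩ := mem_iUnion₂.1 (ht hx)
      exact mem_iUnion.2 ⟨φ ⟨y, hy⟩, by simpa using hxy⟩)
  have hsum : ∀ x, F x = ∑ i, (ψ i x : ℂ) * F x := by
    intro x
    by_cases hx : x ∈ tsupport F
    · have := h2 hx
      simp only [Finset.sum_apply, Pi.one_apply] at this
      rw [← Finset.sum_mul, ← Complex.ofReal_sum, this]
      simp
    · simp [image_eq_zero_of_notMem_tsupport hx]
  have hi : ∀ i, tsupport (fun x => (ψ i x : ℂ) * F x) ⊆ tsupport F := fun i =>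
    closure_mono (support_mul_subset_right _ _)
  have hi' : ∀ i, HasCompactSupport fun x => (ψ i x : ℂ) * F x := fun i =>
    hF'.isCompact.of_isClosed_subset isClosed_closure (hi i)
  have hfs : fibreSum p F = fun x => ∑ i, fibreSum p (fun x => (ψ i x : ℂ) * F x) x := by
    funext x
    simp only [fibreSum]
    rw [← finsum_sum_comm _ _ fun i _ => finite_fibre_support hp (hi' i) x]
    exact finsum_congr fun b => hsum b
  rw [hfs]
  refine continuous_finsetSum _ fun i _ => ?_
  refine continuous_fibreSum_of_subset (e (φ.symm i)) (hpe _) (by fun_prop) (hi' i) ?_ hp.continuous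
  refine Subset.trans (closure_mono ?_) (h1 i)
  intro x hx h0
  apply hx
  simp [h0]

theorem hasCompactSupport_fibreSum [T2Space X] {p : E → X} (hp : Continuous p) {F : E → ℂ}
    (hF' : HasCompactSupport F) : HasCompactSupport (fibreSum p F) := by
  refine HasCompactSupport.intro (hF'.isCompact.image hp) fun x hx => ?_
  refine finsum_eq_zero_of_forall_eq_zero ?_
  rintro ⟨b, hb⟩
  by_contra h0
  exact hx ⟨b, subset_tsupport F h0, hb⟩

end FibreSum

/-- A topological groupoid: a space of objects `G₀`, a space of arrows `G₁`, and continuous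
domain, range, unit, inversion and multiplication maps; `mul g h w` is defined exactly when
`d g = r h`. The map `u` is a common section of `d` and `r`. -/
structure TopologicalGroupoid (G₀ G₁ : Type*) [TopologicalSpace G₀] [TopologicalSpace G₁] where
  d : G₁ → G₀
  r : G₁ → G₀
  u : G₀ → G₁
  inv : G₁ → G₁
  mul : (g h : G₁) → d g = r h → G₁
  continuous_d : Continuous d
  continuous_r : Continuous r
  continuous_u : Continuous u
  continuous_inv : Continuous inv
  continuous_mul : Continuous fun p : {p : G₁ × G₁ // d p.1 = r p.2} => mul p.1.1 p.1.2 p.2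
  d_u : ∀ x, d (u x) = x
  r_u : ∀ x, r (u x) = x
  d_mul : ∀ g h (w : d g = r h), d (mul g h w) = d h
  r_mul : ∀ g h (w : d g = r h), r (mul g h w) = r g
  mul_assoc : ∀ g h k (w : d g = r h) (w' : d h = r k),
    mul g (mul h k w') (w.trans (r_mul h k w').symm) =
      mul (mul g h w) k ((d_mul g h w).trans w')
  mul_u : ∀ g, mul g (u (d g)) (r_u (d g)).symm = g
  u_mul : ∀ g, mul (u (r g)) g (d_u (r g)) = g
  d_inv : ∀ g, d (inv g) = r g
  r_inv : ∀ g, r (inv g) = d g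
  inv_mul : ∀ g, mul (inv g) g (d_inv g) = u (d g)
  mul_inv : ∀ g, mul g (inv g) (r_inv g).symm = u (r g)

/-- An étale groupoid: the domain map is a local homeomorphism. -/
structure EtaleGroupoid (G₀ G₁ : Type*) [TopologicalSpace G₀] [TopologicalSpace G₁] extends
    TopologicalGroupoid G₀ G₁ where
  isLocalHomeomorph_d : IsLocalHomeomorph d

theorem isLocalHomeomorph_pullback {A B X : Type*} [TopologicalSpace A] [TopologicalSpace B]
    [TopologicalSpace X] {f : A → X} {g : B → X} (hf : IsLocalHomeomorph f) (hg : Continuous g) :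
    IsLocalHomeomorph fun p : {p : A × B // f p.1 = g p.2} => p.1.2 := by
  refine IsLocalHomeomorph.mk _ fun p => ?_
  obtain ⟨e, he, rfl⟩ := hf p.1.1
  let E : OpenPartialHomeomorph {p : A × B // e p.1 = g p.2} B :=
    { toFun := fun q => q.1.2
      invFun := fun b => by
        classical exact if h : e (e.symm (g b)) = g b then ⟨(e.symm (g b), b), h⟩ else p
      source := {q | q.1.1 ∈ e.source}
      target := {b | g b ∈ e.target}
      map_source' := by
        intro q hq
        change g q.1.2 ∈ e.target
        rw [← q.2]
        exact e.map_source hq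
      map_target' := by
        intro b hb
        have h : e (e.symm (g b)) = g b :=  e.right_inv hb
        simp only [h, dif_pos]
        exact e.map_target hb
      left_inv' := by
        intro q hq
        have h0 : e.symm (g q.1.2) = q.1.1 := by
          rw [← q.2]
          exact e.left_inv hq
        have h : e (e.symm (g q.1.2)) = g q.1.2 := by rw [h0, q.2]
        simp only [h, dif_pos]
        ext <;> simp [h0]
      right_inv' := by
        intro b hb
        have h : e (e.symm (g b)) = g b :=  e.right_inv hb
        simp only [h, dif_pos]
      open_source := e.open_source.preimage (by fun_prop)
      open_target := e.open_target.preimage hg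
      continuousOn_toFun := by fun_prop
      continuousOn_invFun := by
        refine IsInducing.subtypeVal.continuousOn_iff.2 ?_
        have : ContinuousOn (fun b => (e.symm (g b), b)) {b | g b ∈ e.target} :=
          (e.continuousOn_symm.comp hg.continuousOn fun b hb => hb).prodMk continuousOn_id
        refine this.congr fun b hb => ?_
        have h : e (e.symm (g b)) = g b :=  e.right_inv hb
        simp only [Function.comp, h, dif_pos] }
  exact ⟨E, he, fun _ _ => rfl⟩

namespace TopologicalGroupoid
variable {G₀ G₁ : Type*} [TopologicalSpace G₀] [TopologicalSpace G₁]

/-- The space of composable pairs `G₂`, with the subspace topology of `G₁ × G₁`. -/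
abbrev Comp (G : TopologicalGroupoid G₀ G₁) : Type _ := {p : G₁ × G₁ // G.d p.1 = G.r p.2}

/-- The multiplication map `G₂ → G₁`. -/
def mulMap (G : TopologicalGroupoid G₀ G₁) (p : G.Comp) : G₁ := G.mul p.1.1 p.1.2 p.2

theorem t2Space_objects [T2Space G₁] (G : TopologicalGroupoid G₀ G₁) : T2Space G₀ :=
  T2Space.of_injective_continuous (f := G.u) (fun x y h => by rw [← G.d_u x, h, G.d_u])
    G.continuous_u

theorem inv_mul_cancel_left (G : TopologicalGroupoid G₀ G₁) (g h : G₁) (w : G.d g = G.r h) :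
    G.mul (G.inv g) (G.mul g h w) (by rw [G.d_inv, G.r_mul]) = h := by
  rw [G.mul_assoc _ _ _ (G.d_inv g) w]
  have := G.u_mul h
  simp only [G.inv_mul, w]
  exact this

theorem mul_inv_cancel_right (G : TopologicalGroupoid G₀ G₁) (g h : G₁) (w : G.d g = G.r h) :
    G.mul (G.mul g h w) (G.inv h) (by rw [G.d_mul, G.r_inv]) = g := by
  rw [← G.mul_assoc _ _ _ w (G.r_inv h).symm]
  have := G.mul_u g
  simp only [G.mul_inv, ← w]
  exact this

theorem inv_mul_cancel_right (G : TopologicalGroupoid G₀ G₁) (g h : G₁) (w : G.d g = G.d h) :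
    G.mul (G.mul g (G.inv h) (w.trans (G.r_inv h).symm)) h (by rw [G.d_mul, G.d_inv]) = g := by
  rw [← G.mul_assoc _ _ _ (w.trans (G.r_inv h).symm) (G.d_inv h)]
  have := G.mul_u g
  simp only [G.inv_mul, ← w]
  exact this

theorem inv_inv (G : TopologicalGroupoid G₀ G₁) (g : G₁) : G.inv (G.inv g) = g := by
  have h1 := G.inv_mul_cancel_left (G.inv g) g (G.d_inv g)
  have h2 := G.mul_u (G.inv (G.inv g))
  rw [← h2]
  conv_rhs => rw [← h1]
  simp only [G.inv_mul, G.d_inv, G.r_inv]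

end TopologicalGroupoid

namespace EtaleGroupoid
variable {G₀ G₁ : Type*} [TopologicalSpace G₀] [TopologicalSpace G₁]

theorem isLocalHomeomorph_mulMap (G : EtaleGroupoid G₀ G₁) : IsLocalHomeomorph G.mulMap := by
  have h1 := isLocalHomeomorph_pullback G.isLocalHomeomorph_d G.continuous_r
  have h2 := G.isLocalHomeomorph_d.comp h1
  refine IsLocalHomeomorph.of_comp (g := G.d) ?_ G.isLocalHomeomorph_d G.continuous_mul
  convert h2 using 1
  funext p
  exact G.d_mul _ _ _

end EtaleGroupoid

section SchurBound

variable {I : Type*}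

theorem sum_sq_kernel_le {K : I → I → ℂ} {C : ℝ} (hC : ∀ x z, ‖K x z‖ ≤ C) {n : ℕ}
    (hr : ∀ x, {z | K x z ≠ 0}.encard ≤ n) (hc : ∀ z, {x | K x z ≠ 0}.encard ≤ n)
    (ξ : lp (fun _ : I => ℂ) 2) (s : Finset I) :
    ∑ x ∈ s, ‖∑ᶠ z, K x z * ξ z‖ ^ 2 ≤ (n * C * ‖ξ‖) ^ 2 := by
  classical
  have hfr : ∀ x, {z | K x z ≠ 0}.Finite := fun x =>
    encard_lt_top_iff.1 ((hr x).trans_lt (ENat.natCast_lt_top n))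
  let T : I → Finset I := fun x => (hfr x).toFinset
  have hT : ∀ x, (T x).card ≤ n := fun x => by
    have := hr x
    rw [(hfr x).encard_eq_coe_toFinset_card] at this
    exact_mod_cast this
  have h1 : ∀ x, ‖∑ᶠ z, K x z * ξ z‖ ^ 2 ≤ n * C ^ 2 * ∑ z ∈ T x, ‖ξ z‖ ^ 2 := by
    intro x
    have hs : (support fun z => K x z * ξ z) ⊆ T x := by
      intro z hz
      simp only [T, Finite.coe_toFinset]
      exact left_ne_zero_of_mul hz
    rw [finsum_eq_sum_of_support_subset _ hs]
    have h2 : ‖∑ z ∈ T x, K x z * ξ z‖ ≤ ∑ z ∈ T x, C * ‖ξ z‖ := by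
      refine (norm_sum_le _ _).trans (Finset.sum_le_sum fun z _ => ?_)
      rw [norm_mul]
      gcongr
      exact hC x z
    calc ‖∑ z ∈ T x, K x z * ξ z‖ ^ 2 ≤ (∑ z ∈ T x, C * ‖ξ z‖) ^ 2 := by gcongr
      _ ≤ (T x).card * ∑ z ∈ T x, (C * ‖ξ z‖) ^ 2 := sq_sum_le_card_mul_sum_sq
      _ ≤ n * ∑ z ∈ T x, (C * ‖ξ z‖) ^ 2 := by
        gcongr
        exact hT x
      _ = n * C ^ 2 * ∑ z ∈ T x, ‖ξ z‖ ^ 2 := by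
        simp only [mul_pow]
        rw [← Finset.mul_sum, mul_assoc]
  have h3 : ∑ x ∈ s, ∑ z ∈ T x, ‖ξ z‖ ^ 2 ≤ n * ‖ξ‖ ^ 2 := by
    rw [Finset.sum_comm' (t' := s.biUnion T) (s' := fun z => s.filter fun x => z ∈ T x)
      (by intro x y; simp only [Finset.mem_biUnion, Finset.mem_filter]; grind)]
    calc ∑ z ∈ s.biUnion T, ∑ x ∈ s with z ∈ T x, ‖ξ z‖ ^ 2
        ≤ ∑ z ∈ s.biUnion T, n * ‖ξ z‖ ^ 2 := by
          refine Finset.sum_le_sum fun z _ => ?_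
          rw [Finset.sum_const, nsmul_eq_mul]
          gcongr
          have h4 : ((s.filter fun x => z ∈ T x : Finset I) : Set I) ⊆ {x | K x z ≠ 0} := by
            intro x hx
            simpa [T] using (Finset.mem_filter.1 (Finset.mem_coe.1 hx)).2
          have h5 := (encard_le_encard h4).trans (hc z)
          rw [encard_coe_eq_coe_finsetCard] at h5
          exact_mod_cast h5
      _ = n * ∑ z ∈ s.biUnion T, ‖ξ z‖ ^ 2 := by rw [Finset.mul_sum]
      _ ≤ n * ‖ξ‖ ^ 2 := by
          gcongr
          have := lp.sum_rpow_le_norm_rpow (p := 2) (by norm_num) ξ (s.biUnion T)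
          simpa using this
  calc ∑ x ∈ s, ‖∑ᶠ z, K x z * ξ z‖ ^ 2 ≤ ∑ x ∈ s, n * C ^ 2 * ∑ z ∈ T x, ‖ξ z‖ ^ 2 :=
        Finset.sum_le_sum fun x _ => h1 x
    _ = n * C ^ 2 * ∑ x ∈ s, ∑ z ∈ T x, ‖ξ z‖ ^ 2 := by rw [Finset.mul_sum]
    _ ≤ n * C ^ 2 * (n * ‖ξ‖ ^ 2) := by gcongr
    _ = (n * C * ‖ξ‖) ^ 2 := by ring

end SchurBound

namespace TopologicalGroupoid
variable {G₀ G₁ : Type*} [TopologicalSpace G₀] [TopologicalSpace G₁]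

/-- The convolution product `(f * g)(x) = ∑_{x = yz} f(y) g(z)`; it is used when one of the two
functions has compact support and is then a finite sum. -/
noncomputable def conv (G : TopologicalGroupoid G₀ G₁) (f g : G₁ → ℂ) (x : G₁) : ℂ :=
  ∑ᶠ p : G.mulMap ⁻¹' {x}, f p.1.1.1 * g p.1.1.2

/-- The involution `f^*(x) = conj (f(x⁻¹))`. -/
def convStar (G : TopologicalGroupoid G₀ G₁) (f : G₁ → ℂ) (x : G₁) : ℂ := star (f (G.inv x))

open Classical in
/-- The matrix of left convolution by `f`. -/
noncomputable def kernel (G : TopologicalGroupoid G₀ G₁) (f : G₁ → ℂ) (x z : G₁) : ℂ :=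
  if h : G.d x = G.d z then f (G.mul x (G.inv z) (h.trans (G.r_inv z).symm)) else 0

theorem conv_eq_finsum_kernel (G : TopologicalGroupoid G₀ G₁) (f g : G₁ → ℂ) (x : G₁) :
    G.conv f g x = ∑ᶠ z, G.kernel f x z * g z := by
  let i : G.mulMap ⁻¹' {x} → G₁ := fun p => p.1.1.2
  have key : ∀ p : G.mulMap ⁻¹' {x}, ∃ h : G.d x = G.d (i p),
      G.mul x (G.inv (i p)) (h.trans (G.r_inv _).symm) = p.1.1.1 := by
    rintro ⟨⟨⟨y, z⟩, w⟩, rfl⟩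
    exact ⟨G.d_mul y z w, G.mul_inv_cancel_right y z w⟩
  have hi : Injective i := by
    intro p q hpq
    obtain ⟨hp, hp'⟩ := key p
    obtain ⟨hq, hq'⟩ := key q
    have : p.1.1.1 = q.1.1.1 := by
      rw [← hp', ← hq']
      congr 2
    exact Subtype.ext (Subtype.ext (Prod.ext this hpq))
  have h1 : ∀ z, z ∉ range i → G.kernel f x z * g z = 0 := by
    intro z hz
    rw [kernel, dif_neg, zero_mul]
    intro h
    exact hz ⟨⟨⟨(G.mul x (G.inv z) (h.trans (G.r_inv z).symm), z),
      by rw [G.d_mul, G.d_inv]⟩, G.inv_mul_cancel_right x z h⟩, rfl⟩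
  have h2 : (∑ᶠ z ∈ range i, G.kernel f x z * g z) = ∑ᶠ z, G.kernel f x z * g z := by
    refine finsum_congr fun z => ?_
    by_cases hz : z ∈ range i
    · simp only [hz, finsum_true]
    · rw [h1 z hz]; simp
  rw [← h2, finsum_mem_range hi]
  refine finsum_congr fun p => ?_
  obtain ⟨hp, hp'⟩ := key p
  rw [show p.1.1.2 = i p from rfl, kernel, dif_pos hp, hp']

theorem kernel_eq_zero_or (G : TopologicalGroupoid G₀ G₁) (f : G₁ → ℂ) (x z : G₁) :
    G.kernel f x z = 0 ∨ ∃ y, G.kernel f x z = f y := by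
  unfold kernel
  split_ifs with h
  · exact Or.inr ⟨_, rfl⟩
  · exact Or.inl rfl

theorem kernel_add (G : TopologicalGroupoid G₀ G₁) (f g : G₁ → ℂ) (x z : G₁) :
    G.kernel (f + g) x z = G.kernel f x z + G.kernel g x z := by
  unfold kernel
  split_ifs <;> simp

theorem kernel_smul (G : TopologicalGroupoid G₀ G₁) (c : ℂ) (f : G₁ → ℂ) (x z : G₁) :
    G.kernel (c • f) x z = c * G.kernel f x z := by
  unfold kernel
  split_ifs <;> simp

theorem kernel_convStar (G : TopologicalGroupoid G₀ G₁) (f : G₁ → ℂ) (x z : G₁) :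
    G.kernel (G.convStar f) x z = star (G.kernel f z x) := by
  unfold kernel
  by_cases h : G.d x = G.d z
  · rw [dif_pos h, dif_pos h.symm, convStar]
    congr 2
    have h1 := G.inv_mul_cancel_left (G.mul x (G.inv z) (h.trans (G.r_inv z).symm)) z
      (by rw [G.d_mul, G.d_inv])
    have h2 := G.inv_mul_cancel_right x z h
    have h3 := G.mul_inv_cancel_right (G.inv (G.mul x (G.inv z) (h.trans (G.r_inv z).symm))) x
      (by rw [G.d_inv, G.r_mul])
    rw [← h3]
    congr 1
    refine Eq.trans ?_ h1
    congr 1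
    exact h2.symm
  · rw [dif_neg h, dif_neg (Ne.symm h), star_zero]

theorem kernel_unit (G : TopologicalGroupoid G₀ G₁) (f : G₁ → ℂ) (x : G₁) :
    G.kernel f x (G.u (G.d x)) = f x := by
  rw [kernel, dif_pos (G.d_u _).symm]
  congr 1
  have h2 := G.inv_mul_cancel_right x (G.u (G.d x)) (G.d_u _).symm
  have h3 := G.mul_u (G.mul x (G.inv (G.u (G.d x))) ((G.d_u _).symm.trans (G.r_inv _).symm))
  have h4 : G.d (G.mul x (G.inv (G.u (G.d x))) ((G.d_u _).symm.trans (G.r_inv _).symm)) = G.d x := by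
    rw [G.d_mul, G.d_inv, G.r_u]
  rw [← h3]
  conv_rhs => rw [← h2]
  congr 2

theorem conv_kernel (G : TopologicalGroupoid G₀ G₁) (f g : G₁ → ℂ) (x h : G₁) :
    G.conv f (fun z => G.kernel g z h) x = G.kernel (G.conv f g) x h := by
  by_cases hx : G.d x = G.d h
  · rw [kernel, dif_pos hx, conv, conv]
    let wd : ∀ z, G.d z = G.d h → G.d z = G.r (G.inv h) := fun z hz => hz.trans (G.r_inv h).symm
    have hz : ∀ p : G.mulMap ⁻¹' {x}, G.d p.1.1.2 = G.d h := by
      rintro ⟨⟨⟨y, z⟩, w⟩, rfl⟩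
      exact (G.d_mul y z w).symm.trans hx
    let φ : G.mulMap ⁻¹' {x} → G.mulMap ⁻¹' {G.mul x (G.inv h) (wd x hx)} := fun p =>
      ⟨⟨(p.1.1.1, G.mul p.1.1.2 (G.inv h) (wd _ (hz p))), by rw [G.r_mul]; exact p.1.2⟩, by
        have h1 := G.mul_assoc p.1.1.1 p.1.1.2 (G.inv h) p.1.2 (wd _ (hz p))
        have h2 : G.mul p.1.1.1 p.1.1.2 p.1.2 = x := p.2
        change G.mul _ _ _ = _
        rw [h1]
        congr 1⟩
    have hφ : Bijective φ := by
      constructor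
      · intro p q hpq
        have h1 : p.1.1.1 = q.1.1.1 := congrArg (fun t => t.1.1.1) hpq
        have h2 : G.mul p.1.1.2 (G.inv h) (wd _ (hz p)) = G.mul q.1.1.2 (G.inv h) (wd _ (hz q)) :=
          congrArg (fun t => t.1.1.2) hpq
        have h3 := G.inv_mul_cancel_right p.1.1.2 h (hz p)
        have h4 := G.inv_mul_cancel_right q.1.1.2 h (hz q)
        have h5 : p.1.1.2 = q.1.1.2 := by
          rw [← h3, ← h4]
          congr 1
        exact Subtype.ext (Subtype.ext (Prod.ext h1 h5))
      · rintro ⟨⟨⟨y, z⟩, w⟩, hyz⟩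
        have w : G.d y = G.r z := w
        have hyz : G.mul y z w = _ := hyz
        have hzd : G.d z = G.r h := by
          rw [← G.d_mul y z w, hyz, G.d_mul, G.d_inv]
        refine ⟨⟨⟨(y, G.mul z h hzd), by rw [G.r_mul]; exact w⟩, ?_⟩, ?_⟩
        · change G.mul y (G.mul z h hzd) _ = x
          rw [G.mul_assoc y z h w hzd, ← G.inv_mul_cancel_right x h hx]
          congr 1
        · refine Subtype.ext (Subtype.ext (Prod.ext rfl ?_))
          exact G.mul_inv_cancel_right z h hzd
    refine finsum_eq_of_bijective φ hφ fun p => ?_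
    rw [kernel, dif_pos (hz p)]
  · rw [kernel, dif_neg hx, conv]
    refine finsum_eq_zero_of_forall_eq_zero ?_
    rintro ⟨⟨⟨y, z⟩, w⟩, rfl⟩
    have : ¬ G.d z = G.d h := fun h' => hx ((G.d_mul y z w).trans h')
    simp [kernel, this]

end TopologicalGroupoid

namespace EtaleGroupoid
variable {G₀ G₁ : Type*} [TopologicalSpace G₀] [TopologicalSpace G₁]

theorem isLocalHomeomorph_r (G : EtaleGroupoid G₀ G₁) : IsLocalHomeomorph G.r := by
  let e : G₁ ≃ₜ G₁ :=
    { toFun := G.inv, invFun := G.inv, left_inv := G.inv_inv, right_inv := G.inv_inv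
      continuous_toFun := G.continuous_inv, continuous_invFun := G.continuous_inv }
  have := G.isLocalHomeomorph_d.comp e.isLocalHomeomorph
  convert this using 1
  funext g
  exact (G.d_inv g).symm

theorem exists_kernel_bound (G : EtaleGroupoid G₀ G₁) {f : G₁ → ℂ} (hf : HasCompactSupport f) :
    ∃ n : ℕ, (∀ x, {z | G.kernel f x z ≠ 0}.encard ≤ n) ∧
      (∀ z, {x | G.kernel f x z ≠ 0}.encard ≤ n) := by
  classical
  obtain ⟨n, hn⟩ := exists_fibre_bound G.isLocalHomeomorph_r hf
  obtain ⟨m, hm⟩ := exists_fibre_bound G.isLocalHomeomorph_d hf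
  let q : G₁ → G₁ → G₁ := fun x z =>
    if h : G.d x = G.d z then G.mul x (G.inv z) (h.trans (G.r_inv z).symm) else x
  have hq : ∀ x z, G.kernel f x z ≠ 0 → ∃ h : G.d x = G.d z,
      q x z = G.mul x (G.inv z) (h.trans (G.r_inv z).symm) ∧ q x z ∈ tsupport f := by
    intro x z hxz
    have h : G.d x = G.d z := by
      by_contra h
      exact hxz (dif_neg h)
    refine ⟨h, dif_pos h, subset_tsupport f ?_⟩
    simpa only [TopologicalGroupoid.kernel, q, h, dif_pos, mem_support] using hxz
  refine ⟨max n m, fun x => ?_, fun z => ?_⟩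
  · refine le_trans ?_ ((hn (G.r x)).trans (by exact_mod_cast le_max_left n m))
    refine encard_le_encard_of_injOn (f := fun z => q x z) ?_ ?_
    · intro z hz
      obtain ⟨h, h1, h2⟩ := hq x z hz
      exact ⟨h2, by change G.r (q x z) = _; rw [h1, G.r_mul]⟩
    · intro z hz z' hz' hzz
      obtain ⟨h, h1, h2⟩ := hq x z hz
      obtain ⟨h', h1', h2'⟩ := hq x z' hz'
      have hzz : q x z = q x z' := hzz
      rw [h1, h1'] at hzz
      have a := G.inv_mul_cancel_left x (G.inv z) (h.trans (G.r_inv z).symm)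
      have a' := G.inv_mul_cancel_left x (G.inv z') (h'.trans (G.r_inv z').symm)
      have : G.inv z = G.inv z' := by
        rw [← a, ← a']
        congr 1
      rw [← G.inv_inv z, this, G.inv_inv]
  · refine le_trans ?_ ((hm (G.r z)).trans (by exact_mod_cast le_max_right n m))
    refine encard_le_encard_of_injOn (f := fun x => q x z) ?_ ?_
    · intro x hx
      obtain ⟨h, h1, h2⟩ := hq x z hx
      exact ⟨h2, by change G.d (q x z) = _; rw [h1, G.d_mul, G.d_inv]⟩
    · intro x hx x' hx' hxx
      obtain ⟨h, h1, h2⟩ := hq x z hx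
      obtain ⟨h', h1', h2'⟩ := hq x' z hx'
      have hxx : q x z = q x' z := hxx
      rw [h1, h1'] at hxx
      rw [← G.inv_mul_cancel_right x z h, ← G.inv_mul_cancel_right x' z h']
      congr 1

end EtaleGroupoid

namespace EtaleGroupoid
variable {G₀ G₁ : Type*} [TopologicalSpace G₀] [TopologicalSpace G₁]

open scoped CompactlySupported

theorem continuous_conv [T2Space G₁] [LocallyCompactSpace G₁] (G : EtaleGroupoid G₀ G₁)
    (f g : C_c(G₁, ℂ)) : Continuous (G.conv f g) ∧ HasCompactSupport (G.conv f g) := by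
  have := G.t2Space_objects
  have hcl : IsClosed {p : G₁ × G₁ | G.d p.1 = G.r p.2} :=
    isClosed_eq (G.continuous_d.comp continuous_fst) (G.continuous_r.comp continuous_snd)
  have : LocallyCompactSpace G.Comp := hcl.isClosedEmbedding_subtypeVal.locallyCompactSpace
  let F : G.Comp → ℂ := fun p => f p.1.1 * g p.1.2
  have hF : Continuous F := by
    have := f.continuous
    have := g.continuous
    fun_prop
  have hF' : HasCompactSupport F := by
    have h1 : IsCompact ((Subtype.val : G.Comp → G₁ × G₁) ⁻¹' (tsupport f ×ˢ tsupport g)) :=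
      hcl.isClosedEmbedding_subtypeVal.isCompact_preimage
        (f.hasCompactSupport.isCompact.prod g.hasCompactSupport.isCompact)
    refine HasCompactSupport.intro h1 fun p hp => ?_
    by_contra h0
    exact hp ⟨subset_tsupport f (left_ne_zero_of_mul h0), subset_tsupport g (right_ne_zero_of_mul h0)⟩
  exact ⟨continuous_fibreSum G.isLocalHomeomorph_mulMap hF hF',
    hasCompactSupport_fibreSum G.isLocalHomeomorph_mulMap.continuous hF'⟩

/-- The convolution of two functions in `C_c(G)`, as an element of `C_c(G)`. -/
noncomputable def convCc [T2Space G₁] [LocallyCompactSpace G₁] (G : EtaleGroupoid G₀ G₁)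
    (f g : C_c(G₁, ℂ)) : C_c(G₁, ℂ) where
  toFun := G.conv f g
  continuous_toFun := (G.continuous_conv f g).1
  hasCompactSupport' := (G.continuous_conv f g).2

/-- The involution of `C_c(G)`. -/
noncomputable def starCc [T2Space G₁] (G : EtaleGroupoid G₀ G₁) (f : C_c(G₁, ℂ)) : C_c(G₁, ℂ) where
  toFun := G.convStar f
  continuous_toFun := (f.continuous.comp G.continuous_inv).star
  hasCompactSupport' := by
    refine HasCompactSupport.intro (f.hasCompactSupport.isCompact.image G.continuous_inv)
      fun x hx => ?_
    have : f (G.inv x) = 0 := by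
      by_contra h0
      exact hx ⟨G.inv x, subset_tsupport f h0, G.inv_inv x⟩
    simp [TopologicalGroupoid.convStar, this]

theorem exists_regRep_bound (G : EtaleGroupoid G₀ G₁) (f : C_c(G₁, ℂ)) :
    ∃ C : ℝ, 0 ≤ C ∧ ∀ (ξ : lp (fun _ : G₁ => ℂ) 2) (s : Finset G₁),
      ∑ x ∈ s, ‖G.conv f ξ x‖ ^ 2 ≤ (C * ‖ξ‖) ^ 2 := by
  obtain ⟨n, h1, h2⟩ := G.exists_kernel_bound f.hasCompactSupport
  obtain ⟨C, hC⟩ := f.continuous.bounded_above_of_compact_support f.hasCompactSupport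
  have hC' : ∀ x z, ‖G.kernel f x z‖ ≤ max C 0 := by
    intro x z
    rcases G.kernel_eq_zero_or f x z with h | ⟨y, h⟩
    · simp [h]
    · rw [h]
      exact (hC y).trans (le_max_left _ _)
  refine ⟨n * max C 0, by positivity, fun ξ s => ?_⟩
  simp only [G.conv_eq_finsum_kernel]
  exact sum_sq_kernel_le hC' h1 h2 ξ s

theorem conv_memlp (G : EtaleGroupoid G₀ G₁) (f : C_c(G₁, ℂ)) (ξ : lp (fun _ : G₁ => ℂ) 2) :
    Memℓp (G.conv f ξ) 2 := by
  obtain ⟨C, -, hC⟩ := G.exists_regRep_bound f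
  refine memℓp_gen' (C := (C * ‖ξ‖) ^ 2) fun s => ?_
  simpa using hC ξ s

theorem finite_kernel_support (G : EtaleGroupoid G₀ G₁) (f : C_c(G₁, ℂ)) (g : G₁ → ℂ) (x : G₁) :
    (support fun z => G.kernel f x z * g z).Finite := by
  obtain ⟨n, h1, -⟩ := G.exists_kernel_bound f.hasCompactSupport
  refine (encard_lt_top_iff.1 ((h1 x).trans_lt (ENat.natCast_lt_top n))).subset ?_
  intro z hz
  exact left_ne_zero_of_mul hz

/-- The regular representation of `C_c(G)`: `f` acts on `ℓ²(G₁)` by left convolution `ξ ↦ f * ξ`.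
Since `ℓ²(G₁)` is the Hilbert sum of the spaces `ℓ²(d⁻¹{x})` over the objects `x`, this is the direct
sum of the usual regular representations `λ_x`, so that the norm of `regRep f` is the reduced norm
`sup_x ‖λ_x(f)‖` of `f`. -/
noncomputable def regRep (G : EtaleGroupoid G₀ G₁) (f : C_c(G₁, ℂ)) :
    lp (fun _ : G₁ => ℂ) 2 →L[ℂ] lp (fun _ : G₁ => ℂ) 2 :=
  LinearMap.mkContinuousOfExistsBound
    { toFun := fun ξ => ⟨G.conv f ξ, G.conv_memlp f ξ⟩
      map_add' := by
        intro ξ η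
        ext x
        simp only [lp.coeFn_add, Pi.add_apply, G.conv_eq_finsum_kernel, mul_add]
        exact finsum_add_distrib (G.finite_kernel_support f ξ x) (G.finite_kernel_support f η x)
      map_smul' := by
        intro c ξ
        ext x
        simp only [lp.coeFn_smul, Pi.smul_apply, G.conv_eq_finsum_kernel, RingHom.id_apply,
          smul_finsum]
        exact finsum_congr fun z => by simp only [smul_eq_mul]; ring }
    (by
      obtain ⟨C, hC0, hC⟩ := G.exists_regRep_bound f
      refine ⟨C, fun ξ => ?_⟩
      refine lp.norm_le_of_forall_sum_le (by norm_num) (by positivity) fun s => ?_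
      simpa using hC ξ s)

theorem regRep_apply (G : EtaleGroupoid G₀ G₁) (f : C_c(G₁, ℂ)) (ξ : lp (fun _ : G₁ => ℂ) 2)
    (x : G₁) : G.regRep f ξ x = G.conv f ξ x := rfl

open Classical in
theorem regRep_single (G : EtaleGroupoid G₀ G₁) (f : C_c(G₁, ℂ)) (h x : G₁) :
    G.regRep f (lp.single 2 h 1) x = G.kernel f x h := by
  rw [regRep_apply, G.conv_eq_finsum_kernel, finsum_eq_single _ h]
  · simp
  · intro z hz
    simp [hz]

theorem ext_single {I : Type*} {S T : lp (fun _ : I => ℂ) 2 →L[ℂ] lp (fun _ : I => ℂ) 2}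
    (h : ∀ i j, open Classical in S (lp.single 2 i 1) j = T (lp.single 2 i 1) j) : S = T := by
  classical
  refine lp.ext_continuousLinearMap (by norm_num) fun i => ?_
  ext j
  simpa using h i j

theorem regRep_add (G : EtaleGroupoid G₀ G₁) (f g : C_c(G₁, ℂ)) :
    G.regRep (f + g) = G.regRep f + G.regRep g := by
  refine ext_single fun i j => ?_
  simp only [add_apply, lp.coeFn_add, Pi.add_apply, regRep_single]
  exact G.kernel_add f g j i

theorem regRep_smul (G : EtaleGroupoid G₀ G₁) (c : ℂ) (f : C_c(G₁, ℂ)) :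
    G.regRep (c • f) = c • G.regRep f := by
  refine ext_single fun i j => ?_
  simp only [smul_apply, lp.coeFn_smul, Pi.smul_apply, regRep_single]
  exact G.kernel_smul c f j i

theorem regRep_mul [T2Space G₁] [LocallyCompactSpace G₁] (G : EtaleGroupoid G₀ G₁)
    (f g : C_c(G₁, ℂ)) : G.regRep (G.convCc f g) = G.regRep f * G.regRep g := by
  classical
  refine ext_single fun i j => ?_
  have h1 : (G.regRep f * G.regRep g) (lp.single 2 i 1) j =
      G.conv f (G.regRep g (lp.single 2 i 1)) j := rfl
  have : (G.regRep g (lp.single 2 i 1) : G₁ → ℂ) = fun z => G.kernel g z i := by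
    funext z
    exact G.regRep_single g i z
  rw [regRep_single, h1, this, G.conv_kernel]
  rfl

theorem regRep_star [T2Space G₁] (G : EtaleGroupoid G₀ G₁) (f : C_c(G₁, ℂ)) :
    G.regRep (G.starCc f) = star (G.regRep f) := by
  classical
  refine ext_single fun i j => ?_
  rw [regRep_single]
  have h1 : ∀ ξ : lp (fun _ : G₁ => ℂ) 2, ξ j = inner ℂ (lp.single 2 j (1 : ℂ)) ξ := by
    intro ξ
    rw [lp.inner_single_left]
    simp
  rw [h1, ContinuousLinearMap.star_eq_adjoint, ContinuousLinearMap.adjoint_inner_right,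
    lp.inner_single_right, regRep_single]
  have := G.kernel_convStar f j i
  rw [show (G.starCc f : G₁ → ℂ) = G.convStar f from rfl, this]
  simp

/-- The image of the convolution `*`-algebra `C_c(G)` under the regular representation. -/
noncomputable def convAlgebra [T2Space G₁] [LocallyCompactSpace G₁] (G : EtaleGroupoid G₀ G₁) :
    NonUnitalStarSubalgebra ℂ (lp (fun _ : G₁ => ℂ) 2 →L[ℂ] lp (fun _ : G₁ => ℂ) 2) where
  carrier := range G.regRep
  add_mem' := by
    rintro _ _ ⟨f, rfl⟩ ⟨g, rfl⟩
    exact ⟨f + g, G.regRep_add f g⟩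
  zero_mem' := ⟨0, by simpa using G.regRep_smul 0 0⟩
  mul_mem' := by
    rintro _ _ ⟨f, rfl⟩ ⟨g, rfl⟩
    exact ⟨G.convCc f g, G.regRep_mul f g⟩
  smul_mem' := by
    rintro c _ ⟨f, rfl⟩
    exact ⟨c • f, G.regRep_smul c f⟩
  star_mem' := by
    rintro _ ⟨f, rfl⟩
    exact ⟨G.starCc f, G.regRep_star f⟩

/-- The norm closure of the image of `C_c(G)` under the regular representation. -/
noncomputable def reducedCStarSubalgebra [T2Space G₁] [LocallyCompactSpace G₁]
    (G : EtaleGroupoid G₀ G₁) :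
    NonUnitalStarSubalgebra ℂ (lp (fun _ : G₁ => ℂ) 2 →L[ℂ] lp (fun _ : G₁ => ℂ) 2) :=
  G.convAlgebra.topologicalClosure

instance [T2Space G₁] [LocallyCompactSpace G₁] (G : EtaleGroupoid G₀ G₁) :
    IsClosed (G.reducedCStarSubalgebra :
      Set (lp (fun _ : G₁ => ℂ) 2 →L[ℂ] lp (fun _ : G₁ => ℂ) 2)) :=
  NonUnitalStarSubalgebra.isClosed_topologicalClosure _

/-- The reduced C*-algebra `C_r^*(G)`: the completion of `C_c(G)` in the reduced norm. -/
noncomputable abbrev ReducedCStarAlgebra [T2Space G₁] [LocallyCompactSpace G₁] (G : EtaleGroupoid G₀ G₁) : Type _ :=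
  G.reducedCStarSubalgebra

/-- The canonical linear map `C_c(G) → C_r^*(G)`. -/
noncomputable def toReduced [T2Space G₁] [LocallyCompactSpace G₁] (G : EtaleGroupoid G₀ G₁) :
    C_c(G₁, ℂ) →ₗ[ℂ] G.ReducedCStarAlgebra where
  toFun f := ⟨G.regRep f, G.convAlgebra.le_topologicalClosure ⟨f, rfl⟩⟩
  map_add' f g := Subtype.ext (G.regRep_add f g)
  map_smul' c f := Subtype.ext (G.regRep_smul c f)

open Classical in
/-- The matrix coefficient `⟨δ_x, T δ_{u(d(x))}⟩` of an operator `T` on `ℓ²(G₁)`. It extends the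
inclusion of `C_c(G)` into the functions on `G₁` continuously to `C_r^*(G)`. -/
noncomputable def evalOp (G : EtaleGroupoid G₀ G₁)
    (T : lp (fun _ : G₁ => ℂ) 2 →L[ℂ] lp (fun _ : G₁ => ℂ) 2) (x : G₁) : ℂ :=
  T (lp.single 2 (G.u (G.d x)) 1) x

theorem evalOp_regRep (G : EtaleGroupoid G₀ G₁) (f : C_c(G₁, ℂ)) : G.evalOp (G.regRep f) = f := by
  funext x
  rw [evalOp, regRep_single, G.kernel_unit]

theorem continuous_evalOp [T2Space G₁] [LocallyCompactSpace G₁] (G : EtaleGroupoid G₀ G₁)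
    (a : G.ReducedCStarAlgebra) : Continuous (G.evalOp a) := by
  classical
  refine continuous_of_uniform_approx_of_continuous fun v hv => ?_
  obtain ⟨ε, hε, hv⟩ := Metric.mem_uniformity_dist.1 hv
  obtain ⟨_, ⟨f, rfl⟩, hf⟩ := Metric.mem_closure_iff.1 a.2 ε hε
  refine ⟨f, f.continuous, fun x => hv ?_⟩
  rw [← G.evalOp_regRep f, dist_eq_norm]
  rw [dist_eq_norm] at hf
  refine lt_of_le_of_lt ?_ hf
  have h1 : G.evalOp a x - G.evalOp (G.regRep f) x =
      ((a : lp (fun _ : G₁ => ℂ) 2 →L[ℂ] lp (fun _ : G₁ => ℂ) 2) - G.regRep f)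
        (lp.single 2 (G.u (G.d x)) 1) x := rfl
  rw [h1]
  refine (lp.norm_apply_le_norm (by norm_num) _ x).trans ?_
  refine (ContinuousLinearMap.le_opNorm _ _).trans ?_
  rw [lp.norm_single (by norm_num)]
  simp

/-- An element of `C_r^*(G)` regarded as a function on `G₁`. -/
noncomputable def toFunction [T2Space G₁] [LocallyCompactSpace G₁] (G : EtaleGroupoid G₀ G₁)
    (a : G.ReducedCStarAlgebra) (x : G₁) : ℂ :=
  G.evalOp (a : lp (fun _ : G₁ => ℂ) 2 →L[ℂ] lp (fun _ : G₁ => ℂ) 2) x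

theorem toFunction_toReduced [T2Space G₁] [LocallyCompactSpace G₁] (G : EtaleGroupoid G₀ G₁)
    (f : C_c(G₁, ℂ)) : G.toFunction (G.toReduced f) = f :=
  G.evalOp_regRep f

end EtaleGroupoid

section MeasurementSpaces

/-- A complete lattice with a topology is a sober lattice if the space is sober, its specialization
order (`x ≤ y` iff `x` is in the closure of `{y}`) is the given order, and binary joins are
continuous. The specialization order of a sober lattice is always complete. -/
structure IsSoberLattice (L : Type*) [CompleteLattice L] [TopologicalSpace L] : Prop where
  t0Space : T0Space L
  quasiSober : QuasiSober L
  le_iff_mem_closure : ∀ x y : L, x ≤ y ↔ x ∈ closure ({y} : Set L)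
  continuous_sup : Continuous fun p : L × L => p.1 ⊔ p.2

/-- Homomorphisms of sober lattices. -/
structure IsSoberLatticeHom {L M : Type*} [CompleteLattice L] [TopologicalSpace L]
    [CompleteLattice M] [TopologicalSpace M] (f : L → M) : Prop where
  continuous : Continuous f
  map_sup : ∀ x y, f (x ⊔ y) = f x ⊔ f y
  map_bot : f ⊥ = ⊥

/-- Measurement spaces. -/
structure IsMeasurementSpace (M : Type*) [CompleteLattice M] [TopologicalSpace M] [Mul M]
    [Star M] : Prop extends IsSoberLattice M where
  continuous_mul : Continuous fun p : M × M => p.1 * p.2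
  continuous_star : Continuous fun m : M => star m
  mul_assoc : ∀ m n k : M, m * n * k = m * (n * k)
  mul_bot : ∀ m : M, m * ⊥ = ⊥
  mul_sup : ∀ m n n' : M, m * (n ⊔ n') = m * n ⊔ m * n'
  star_star : ∀ m : M, star (star m) = m
  star_mul : ∀ m n : M, star (m * n) = star n * star m
  stablyGelfand : ∀ m : M, m * star m * m ≤ m → m ≤ m * star m * m

/-- Homomorphisms of measurement spaces. -/
structure IsMeasurementSpaceHom {M N : Type*} [CompleteLattice M] [TopologicalSpace M] [Mul M]
    [Star M] [CompleteLattice N] [TopologicalSpace N] [Mul N] [Star N] (h : M → N) : Prop extends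
    IsSoberLatticeHom h where
  map_mul : ∀ m n, h (m * n) = h m * h n
  map_star : ∀ m, h (star m) = star (h m)

/-- The way-below relation. -/
def WayBelow {L : Type*} [CompleteLattice L] (x y : L) : Prop :=
  ∀ D : Set L, D.Nonempty → DirectedOn (· ≤ ·) D → y ≤ sSup D → ∃ z ∈ D, x ≤ z

/-- Spaces of classical measurements: sober lattices which are countably based locally compact
locales (that is, distributive continuous lattices) with the Scott topology. A countable basis is a
countable set `B` such that each `x` is the join of those elements of `B` that are way below it; the
finite joins of elements of `B` then make up a countable basis for which these joins are directed. -/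
structure IsSpaceOfClassicalMeasurements (L : Type*) [CompleteLattice L] [TopologicalSpace L] :
    Prop extends IsSoberLattice L where
  inf_sSup : ∀ (x : L) (S : Set L), x ⊓ sSup S = ⨆ y ∈ S, x ⊓ y
  exists_countable_basis : ∃ B : Set L, B.Countable ∧ ∀ x : L, IsLUB {b ∈ B | WayBelow b x} x
  isScott : IsScott L univ

/-- Classical measurement spaces. -/
structure IsClassicalMeasurementSpace (M : Type*) [CompleteLattice M] [TopologicalSpace M] [Mul M]
    [Star M] : Prop extends IsMeasurementSpace M, IsSpaceOfClassicalMeasurements M where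
  le_mul_star_mul : ∀ m : M, m ≤ m * star m * m

/-- `e` is a two-sided unit of the multiplication. -/
def IsMulUnit {Q : Type*} [Mul Q] (e : Q) : Prop := ∀ q : Q, e * q = q ∧ q * e = q

/-- The partial units `𝓘(Q)` of an involutive quantale `Q` with unit `e`: the elements `s` such that
`s s^* ≤ e` and `s^* s ≤ e`. -/
def partialUnits (Q : Type*) [CompleteLattice Q] [Mul Q] [Star Q] : Set Q :=
  {s | ∃ e : Q, IsMulUnit e ∧ s * star s ≤ e ∧ star s * s ≤ e}

/-- Inverse quantal frames: unital stably Gelfand (involutive) quantales which are also locales and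
whose top element is a join of partial units. -/
structure IsInverseQuantalFrame (Q : Type*) [CompleteLattice Q] [Mul Q] [Star Q] : Prop where
  mul_assoc : ∀ a b c : Q, a * b * c = a * (b * c)
  mul_sSup : ∀ (a : Q) (S : Set Q), a * sSup S = ⨆ b ∈ S, a * b
  sSup_mul : ∀ (S : Set Q) (a : Q), sSup S * a = ⨆ b ∈ S, b * a
  star_star : ∀ a : Q, star (star a) = a
  star_mul : ∀ a b : Q, star (a * b) = star b * star a
  star_sSup : ∀ S : Set Q, star (sSup S) = ⨆ a ∈ S, star a
  exists_unit : ∃ e : Q, IsMulUnit e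
  stablyGelfand : ∀ a : Q, a * star a * a ≤ a → a ≤ a * star a * a
  inf_sSup : ∀ (a : Q) (S : Set Q), a ⊓ sSup S = ⨆ b ∈ S, a ⊓ b
  sSup_partialUnits : sSup (partialUnits Q) = ⊤

/-- The pair `(ι, ρ)` of an embedding `ι : O → M` and a retraction `ρ : M → O` is an observer map
`M → O`. -/
structure IsObserverMap {M O : Type*} [CompleteLattice M] [TopologicalSpace M] [Mul M] [Star M]
    [CompleteLattice O] [TopologicalSpace O] [Mul O] [Star O] (ι : O → M) (ρ : M → O) : Prop where
  isMeasurementSpace_source : IsMeasurementSpace M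
  isMeasurementSpace_target : IsMeasurementSpace O
  isMeasurementSpaceHom : IsMeasurementSpaceHom ι
  isSoberLatticeHom : IsSoberLatticeHom ρ
  retraction : ∀ ω, ρ (ι ω) = ω
  map_star : ∀ m, ρ (star m) = star (ρ m)
  map_mul_embedding : ∀ m ω, ρ (m * ι ω) = ρ m * ω

/-- Étale observers: classical observers on an inverse quantal frame with
`ρ(m) ω ρ(n) ≤ ρ(m ι(ω) n)` whenever `ρ(m)` and `ρ(n)` are partial units. -/
structure IsEtaleObserver {M O : Type*} [CompleteLattice M] [TopologicalSpace M] [Mul M] [Star M]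
    [CompleteLattice O] [TopologicalSpace O] [Mul O] [Star O] (ι : O → M) (ρ : M → O) : Prop
    extends IsObserverMap ι ρ where
  isClassical : IsClassicalMeasurementSpace O
  isInverseQuantalFrame : IsInverseQuantalFrame O
  mul_mul_le : ∀ (ω : O) (m n : M), ρ m ∈ partialUnits O → ρ n ∈ partialUnits O →
    ρ m * ω * ρ n ≤ ρ (m * ι ω * n)

/-- Full observers: the embedding preserves the top element. -/
def IsFullObserver {M O : Type*} [CompleteLattice M] [CompleteLattice O] (ι : O → M) : Prop :=
  ι ⊤ = ⊤

/-- Multiplicative observers. -/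
def IsMultiplicativeObserver {M O : Type*} [CompleteLattice O] [Mul M] [Mul O] (ρ : M → O) : Prop :=
  ∀ m n, ρ (m * n) ≤ ρ m * ρ n

end MeasurementSpaces

section MaxSpace

/-- `Max A`, the set of closed linear subspaces of the C*-algebra `A`, ordered by inclusion. -/
def MaxSpace (A : Type*) [NonUnitalCStarAlgebra A] : Type _ := ClosedSubmodule ℂ A

namespace MaxSpace
variable {A : Type*} [NonUnitalCStarAlgebra A]

noncomputable instance : CompleteLattice (MaxSpace A) :=
  inferInstanceAs (CompleteLattice (ClosedSubmodule ℂ A))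

instance : SetLike (MaxSpace A) A := inferInstanceAs (SetLike (ClosedSubmodule ℂ A) A)

/-- The lower Vietoris topology, generated by the sets `{P | P ∩ U ≠ ∅}` with `U` open in `A`. -/
instance : TopologicalSpace (MaxSpace A) :=
  TopologicalSpace.generateFrom
    {S | ∃ U : Set A, IsOpen U ∧ S = {P : MaxSpace A | ((P : Set A) ∩ U).Nonempty}}

/-- The product of `P` and `Q` is the closed linear span of the products `ab` with `a ∈ P` and
`b ∈ Q`. -/
noncomputable instance : Mul (MaxSpace A) where
  mul P Q := (Submodule.span ℂ {c : A | ∃ a ∈ P, ∃ b ∈ Q, a * b = c}).closure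

/-- The pointwise involution: `a ∈ P^*` if and only if `a^* ∈ P`. -/
instance : Star (MaxSpace A) where
  star P :=
    { carrier := {a : A | star a ∈ P}
      add_mem' := fun {a b} ha hb => by
        change star (a + b) ∈ ClosedSubmodule.toSubmodule P
        rw [star_add]
        exact (ClosedSubmodule.toSubmodule P).add_mem ha hb
      zero_mem' := by
        change star (0 : A) ∈ ClosedSubmodule.toSubmodule P
        rw [star_zero]
        exact (ClosedSubmodule.toSubmodule P).zero_mem
      smul_mem' := fun c a ha => by
        change star (c • a) ∈ ClosedSubmodule.toSubmodule P
        rw [star_smul]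
        exact (ClosedSubmodule.toSubmodule P).smul_mem _ ha
      isClosed' := (ClosedSubmodule.isClosed P).preimage continuous_star }

end MaxSpace

end MaxSpace

namespace EtaleGroupoid
variable {G₀ G₁ : Type*} [TopologicalSpace G₀] [TopologicalSpace G₁]

open scoped CompactlySupported

/-- The topology `𝓞(G₁)` of the étale groupoid `G`, ordered by inclusion, as a measurement space. -/
def OpensSpace (_G : EtaleGroupoid G₀ G₁) : Type _ := TopologicalSpace.Opens G₁

namespace OpensSpace
variable {G : EtaleGroupoid G₀ G₁}

instance : CompleteLattice G.OpensSpace := inferInstanceAs (CompleteLattice (TopologicalSpace.Opens G₁))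

instance : SetLike G.OpensSpace G₁ := inferInstanceAs (SetLike (TopologicalSpace.Opens G₁) G₁)

/-- The Scott topology. -/
instance : TopologicalSpace G.OpensSpace := scott G.OpensSpace univ

/-- The pointwise product `UV = {yz | y ∈ U, z ∈ V, d(y) = r(z)}`. -/
instance : Mul G.OpensSpace where
  mul U V := ⟨G.mulMap '' {p | p.1.1 ∈ U ∧ p.1.2 ∈ V},
    G.isLocalHomeomorph_mulMap.isOpenMap _
      (((TopologicalSpace.Opens.isOpen U).preimage (continuous_fst.comp continuous_subtype_val)).inter
        ((TopologicalSpace.Opens.isOpen V).preimage (continuous_snd.comp continuous_subtype_val)))⟩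

/-- The pointwise involution `U^* = {x⁻¹ | x ∈ U} = {x | x⁻¹ ∈ U}`. -/
instance : Star G.OpensSpace where
  star U := ⟨G.inv ⁻¹' (U : Set G₁), (TopologicalSpace.Opens.isOpen U).preimage G.continuous_inv⟩

end OpensSpace

/-- `C_c(U)`: the functions in `C_c(G)` whose support is contained in `U`. -/
def ccOn (G : EtaleGroupoid G₀ G₁) (U : G.OpensSpace) : Submodule ℂ C_c(G₁, ℂ) where
  carrier := {f | tsupport f ⊆ U}
  add_mem' := fun {f g} hf hg => (tsupport_add (f : G₁ → ℂ) g).trans (union_subset hf hg)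
  zero_mem' := by
    change tsupport (0 : G₁ → ℂ) ⊆ U
    simp
  smul_mem' := fun c f hf =>
    (closure_mono (support_const_smul_subset c (f : G₁ → ℂ))).trans hf

variable [T2Space G₁] [LocallyCompactSpace G₁]

/-- The embedding `U ↦ closure of C_c(U)` in `C_r^*(G)`. -/
noncomputable def closureCc (G : EtaleGroupoid G₀ G₁) (U : G.OpensSpace) :
    MaxSpace G.ReducedCStarAlgebra :=
  ((G.ccOn U).map G.toReduced).closure

/-- The open support `{x | ∃ a ∈ V, a(x) ≠ 0}` of a closed linear subspace `V` of `C_r^*(G)`. -/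
noncomputable def openSupport (G : EtaleGroupoid G₀ G₁) (V : MaxSpace G.ReducedCStarAlgebra) :
    G.OpensSpace :=
  ⟨⋃ a ∈ V, support (G.toFunction a),
    isOpen_biUnion fun a _ => (G.continuous_evalOp a).isOpen_support⟩

end EtaleGroupoid

/-! ### Approximate units from functional calculus -/

section CStarAlgebra

variable {A : Type*} [NonUnitalCStarAlgebra A]

/-! The topologies on both sides are made tractable by a criterion for continuity. A map into
`MaxSpace A` converges to `P` exactly when `P` lies in the lower limit of the family
(`MaxSpace.tendsto_nhds`). Since the lower limit is a closed subspace, this need only be tested on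
generators. A map into the open sets with the Scott topology is continuous exactly when its
membership relation is open (`OpensSpace.continuous_iff_isOpen`), by local compactness. Soberness is
proved on each side by exhibiting the generic point of an irreducible closed set.

The one analytic axiom is the stably Gelfand law for closed subspaces. For `a ∈ P`, the elements `a
* f(a* a)` approximate `a` when `f(t) = t / (t + ε)`. If `P P* P ≤ P`, right multiplication by a
function of `a* a` sends `P` into `P P* P`, hence `a` is a limit of elements of `P P* P`. For open
sets the law is immediate from `x = x x⁻¹ x`.

That `closureCc` preserves joins and products is a local statement, by partitions of unity
(`mem_of_locally_mem`). Locally the second factor lies in a bisection. A cutoff `h` supported there,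
with modulus 1 where needed, satisfies `f = (f * h*) * h`, and this factors a function supported in
a product of open sets.

The open support is left adjoint to `supportedIn`, so it preserves joins. The convolution formula
persists in the completion as a convergent sum over factorizations (`hasSum_toFunction_mul`). A
nonzero value of a product needs a nonzero term, which is multiplicativity. The reverse inclusion
can fail only through cancellation. There is none when the second factor is supported where the
domain map is injective, for then the sum has a single term (`toFunction_mul_of_injOn`). This gives
equivariance for `closureCc`, using bumps on bisections, and the étale inequality, using that
partial units are `d`-injective. -/

theorem exists_cfcₙ_mul_near (a : A) {ε : ℝ} (hε : 0 < ε) :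
    ∃ f : ℝ → ℝ, ‖a - a * cfcₙ f (star a * a)‖ ^ 2 ≤ ε := by
  let := CStarAlgebra.spectralOrder A
  have := CStarAlgebra.spectralOrderedRing A
  set b := star a * a with hb
  have hb0 : 0 ≤ b := star_mul_self_nonneg a
  have hbs : IsSelfAdjoint b := IsSelfAdjoint.of_nonneg hb0
  have hpos : ∀ t ∈ quasispectrum ℝ b, 0 ≤ t := fun t ht => quasispectrum_nonneg_of_nonneg b hb0 t ht
  -- This function vanishes at 0, as the non-unital calculus requires, and tends to 1 at every `t >
  -- 0` as `ε → 0`.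
  let f : ℝ → ℝ := fun t => t / (t + ε)
  have hf : ContinuousOn f (quasispectrum ℝ b) := by
    refine continuousOn_id.div (continuousOn_id.add continuousOn_const) fun t ht => ?_
    have := hpos t ht
    change t + ε ≠ 0
    positivity
  have hf0 : f 0 = 0 := by simp [f]
  refine ⟨f, ?_⟩
  set c := cfcₙ f b with hc
  have hcs : star c = c := (cfcₙ_predicate f b : IsSelfAdjoint c)
  -- By the C*-identity the squared error is the norm of `t (1 - f t)²` evaluated at `b`; the
  -- function is left expanded to match the noncommutative product.
  have key : star (a - a * c) * (a - a * c) =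
      cfcₙ (fun t => t - t * f t - (f t * t - f t * (t * f t))) b := by
    have e1 : cfcₙ (fun t => t * f t) b = b * c := by
      rw [cfcₙ_mul (fun t : ℝ => t) f b, cfcₙ_id' ℝ b]
    have e2 : cfcₙ (fun t => f t * t) b = c * b := by
      rw [cfcₙ_mul f (fun t : ℝ => t) b, cfcₙ_id' ℝ b]
    have e3 : cfcₙ (fun t => f t * (t * f t)) b = c * (b * c) := by
      rw [cfcₙ_mul f (fun t : ℝ => t * f t) b, e1]
    rw [cfcₙ_sub (fun t => t - t * f t) (fun t => f t * t - f t * (t * f t)) b,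
      cfcₙ_sub (fun t : ℝ => t) (fun t => t * f t) b,
      cfcₙ_sub (fun t => f t * t) (fun t => f t * (t * f t)) b, e1, e2, e3, cfcₙ_id' ℝ b,
      star_sub, star_mul, hcs, hb]
    noncomm_ring
  rw [sq, ← CStarRing.norm_star_mul_self, key]
  refine norm_cfcₙ_le fun t ht => ?_
  have h0 := hpos t ht
  have h1 : t - t * f t - (f t * t - f t * (t * f t)) = t * ε ^ 2 / (t + ε) ^ 2 := by
    simp only [f]
    field_simp
    ring
  rw [h1, Real.norm_of_nonneg (by positivity), div_le_iff₀ (by positivity)]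
  -- `ε (t + ε)² - t ε² = ε t² + t ε² + ε³`, a sum of the three hints.
  nlinarith [mul_nonneg hε.le (sq_nonneg t), pow_pos hε 3, mul_nonneg h0 (sq_nonneg ε)]

end CStarAlgebra

/-! ### Closed subspaces of a C*-algebra form a measurement space -/

namespace MaxSpace

variable {A : Type*} [NonUnitalCStarAlgebra A] {X : Type*}

open Filter

instance : AddSubmonoidClass (MaxSpace A) A :=
  inferInstanceAs (AddSubmonoidClass (ClosedSubmodule ℂ A) A)

instance : SMulMemClass (MaxSpace A) ℂ A :=
  inferInstanceAs (SMulMemClass (ClosedSubmodule ℂ A) ℂ A)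

theorem isClosed (P : MaxSpace A) : IsClosed (P : Set A) := ClosedSubmodule.isClosed P

theorem mem_bot {a : A} : a ∈ (⊥ : MaxSpace A) ↔ a = 0 := Iff.rfl

theorem mul_mem_mul {P Q : MaxSpace A} {a b : A} (ha : a ∈ P) (hb : b ∈ Q) : a * b ∈ P * Q :=
  subset_closure (Submodule.subset_span ⟨a, ha, b, hb, rfl⟩)

theorem mul_le {P Q R : MaxSpace A} : P * Q ≤ R ↔ ∀ a ∈ P, ∀ b ∈ Q, a * b ∈ R := by
  refine ⟨fun h a ha b hb => h (mul_mem_mul ha hb), fun h => ?_⟩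
  refine Submodule.closure_le.2 (Submodule.span_le.2 ?_)
  rintro _ ⟨a, ha, b, hb, rfl⟩
  exact h a ha b hb

theorem mem_star {P : MaxSpace A} {a : A} : a ∈ star P ↔ star a ∈ P := Iff.rfl

theorem star_mem_star {P : MaxSpace A} {a : A} (ha : a ∈ P) : star a ∈ star P := by
  rw [mem_star, star_star]
  exact ha

/-- The elements `a` with `a * b ∈ P`. -/
noncomputable def rightDiv (P : MaxSpace A) (b : A) : MaxSpace A :=
  ClosedSubmodule.comap ((ContinuousLinearMap.mul ℂ A).flip b) P

/-- The elements `b` with `a * b ∈ P`. -/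
noncomputable def leftDiv (P : MaxSpace A) (a : A) : MaxSpace A :=
  ClosedSubmodule.comap (ContinuousLinearMap.mul ℂ A a) P

theorem mem_rightDiv {P : MaxSpace A} {a b : A} : a ∈ P.rightDiv b ↔ a * b ∈ P := Iff.rfl

theorem mem_leftDiv {P : MaxSpace A} {a b : A} : b ∈ P.leftDiv a ↔ a * b ∈ P := Iff.rfl

theorem eventually_inter_nonempty {P : MaxSpace A} {a : A} (ha : a ∈ P) {U : Set A} (hU : U ∈ 𝓝 a) :
    ∀ᶠ Q : MaxSpace A in 𝓝 P, ((Q : Set A) ∩ U).Nonempty := by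
  obtain ⟨V, hVU, hV, haV⟩ := mem_nhds_iff.1 hU
  have : IsOpen {Q : MaxSpace A | ((Q : Set A) ∩ V).Nonempty} :=
    TopologicalSpace.isOpen_generateFrom_of_mem ⟨V, hV, rfl⟩
  filter_upwards [this.mem_nhds ⟨a, ha, haV⟩] with Q hQ
  exact hQ.mono (inter_subset_inter_right _ hVU)

/-- The lower limit of a family of closed subspaces. -/
def lowerLimit (l : Filter X) (f : X → MaxSpace A) : MaxSpace A where
  carrier := {a | ∀ U ∈ 𝓝 a, ∀ᶠ x in l, ((f x : Set A) ∩ U).Nonempty}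
  add_mem' := by
    intro a b ha hb U hU
    have h1 : ∀ᶠ p : A × A in 𝓝 a ×ˢ 𝓝 b, p.1 + p.2 ∈ U := by
      rw [← nhds_prod_eq]
      exact (continuous_add.tendsto (a, b)).eventually hU
    obtain ⟨V, hV, W, hW, h⟩ := mem_prod_iff.1 h1
    filter_upwards [ha V hV, hb W hW]
    rintro x ⟨v, hv, hv'⟩ ⟨w, hw, hw'⟩
    exact ⟨v + w, add_mem hv hw, h (mk_mem_prod hv' hw')⟩
  zero_mem' := fun U hU => Eventually.of_forall fun x => ⟨0, zero_mem _, mem_of_mem_nhds hU⟩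
  smul_mem' := by
    intro c a ha U hU
    filter_upwards [ha _ ((continuous_const_smul c).continuousAt.preimage_mem_nhds hU)]
    rintro x ⟨v, hv, hv'⟩
    exact ⟨c • v, SMulMemClass.smul_mem c hv, hv'⟩
  isClosed' := by
    refine isClosed_iff_nhds.2 fun a ha U hU => ?_
    obtain ⟨V, hVU, hV, haV⟩ := mem_nhds_iff.1 hU
    obtain ⟨b, hbV, hb⟩ := ha V (hV.mem_nhds haV)
    filter_upwards [hb V (hV.mem_nhds hbV)] with x hx
    exact hx.mono (inter_subset_inter_right _ hVU)

/-- Subbasic neighbourhoods of `P` are witnessed by single elements of `P`, so convergence is a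
condition on each element separately. Its use is that the right-hand side is an inclusion into a
closed subspace, which may be checked on generators. -/
theorem tendsto_nhds {l : Filter X} {f : X → MaxSpace A} {P : MaxSpace A} :
    Tendsto f l (𝓝 P) ↔ P ≤ lowerLimit l f := by
  constructor
  · intro h a ha U hU
    exact h.eventually (eventually_inter_nonempty ha hU)
  · intro h
    refine TopologicalSpace.tendsto_nhds_generateFrom_iff.2 ?_
    rintro _ ⟨U, hU, rfl⟩ ⟨a, ha, haU⟩
    exact h ha U (hU.mem_nhds haU)

theorem continuous_iff_le_lowerLimit [TopologicalSpace X] {f : X → MaxSpace A} :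
    Continuous f ↔ ∀ x, f x ≤ lowerLimit (𝓝 x) f :=
  continuous_iff_continuousAt.trans (forall_congr' fun _ => tendsto_nhds)

theorem lowerLimit_mono {l : Filter X} {f g : X → MaxSpace A} (h : ∀ x, f x ≤ g x) :
    lowerLimit l f ≤ lowerLimit l g := fun _ ha U hU =>
  (ha U hU).mono fun x hx => hx.mono (inter_subset_inter_left _ (h x))

theorem le_iff_mem_closure {P Q : MaxSpace A} : P ≤ Q ↔ P ∈ closure ({Q} : Set (MaxSpace A)) := by
  rw [mem_closure_iff_nhds]
  constructor
  · intro h t ht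
    have h1 : Tendsto (fun _ : Unit => Q) (pure ()) (𝓝 P) :=
      tendsto_nhds.2 fun a ha U hU => eventually_pure.2 ⟨a, h ha, mem_of_mem_nhds hU⟩
    exact ⟨Q, eventually_pure.1 (h1.eventually ht), rfl⟩
  · intro h a ha
    have : a ∈ closure (Q : Set A) := by
      refine mem_closure_iff_nhds.2 fun U hU => ?_
      obtain ⟨R, hR, rfl⟩ := h _ (eventually_inter_nonempty ha hU)
      rwa [inter_comm]
    rwa [Q.isClosed.closure_eq] at this

/-- The generic point is the closure of the union of the members of `S`. Irreducibility is used
twice: to make this closure additive, and to show that it belongs to `S`. -/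
theorem exists_isGenericPoint {S : Set (MaxSpace A)} (hS : IsIrreducible S) (hc : IsClosed S) :
    ∃ P, IsGenericPoint P S := by
  have hev : ∀ {U : Set A}, IsOpen U →
      IsOpen {Q : MaxSpace A | ((Q : Set A) ∩ U).Nonempty} := fun {U} hU =>
    TopologicalSpace.isOpen_generateFrom_of_mem ⟨U, hU, rfl⟩
  let P : MaxSpace A :=
    { carrier := closure (⋃ Q ∈ S, (Q : Set A))
      add_mem' := by
        intro a b ha hb
        refine mem_closure_iff.2 fun U hU hab => ?_
        have h1 : ∀ᶠ p : A × A in 𝓝 (a, b), p.1 + p.2 ∈ U :=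
          (continuous_add.tendsto (a, b)).eventually (hU.mem_nhds hab)
        obtain ⟨V, W, hV, haV, hW, hbW, h⟩ := mem_nhds_prod_iff'.1 h1
        obtain ⟨v, hvV, hv⟩ := mem_closure_iff.1 ha V hV haV
        obtain ⟨w, hwW, hw⟩ := mem_closure_iff.1 hb W hW hbW
        obtain ⟨Q, hQ, hvQ⟩ := mem_iUnion₂.1 hv
        obtain ⟨R, hR, hwR⟩ := mem_iUnion₂.1 hw
        -- The approximants of `a` and `b` may lie in different members of `S`; irreducibility gives
        -- one member meeting both neighbourhoods, in which they can be added.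
        obtain ⟨T, hT, ⟨v', hv', hv''⟩, w', hw', hw''⟩ :=
          hS.2 _ _ (hev hV) (hev hW) ⟨Q, hQ, v, hvQ, hvV⟩ ⟨R, hR, w, hwR, hwW⟩
        exact ⟨v' + w', h (mk_mem_prod hv'' hw''), mem_iUnion₂.2 ⟨T, hT, add_mem hv' hw'⟩⟩
      zero_mem' := by
        obtain ⟨Q, hQ⟩ := hS.1
        exact subset_closure (mem_iUnion₂.2 ⟨Q, hQ, zero_mem Q⟩)
      smul_mem' := by
        intro c a ha
        refine map_mem_closure (continuous_const_smul c) ha fun b hb => ?_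
        obtain ⟨Q, hQ, hbQ⟩ := mem_iUnion₂.1 hb
        exact mem_iUnion₂.2 ⟨Q, hQ, SMulMemClass.smul_mem c hbQ⟩
      isClosed' := isClosed_closure }
  have hP : ∀ a, a ∈ P ↔ a ∈ closure (⋃ Q ∈ S, (Q : Set A)) := fun _ => Iff.rfl
  refine ⟨P, Subset.antisymm ?_ ?_⟩
  · refine hc.closure_subset_iff.2 (singleton_subset_iff.2 ?_)
    rw [← hc.closure_eq]
    refine (TopologicalSpace.isTopologicalBasis_of_subbasis rfl).mem_closure_iff.2 ?_
    rintro _ ⟨F, ⟨hF, hFs⟩, rfl⟩ hPF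
    obtain ⟨F, rfl⟩ := hF.exists_finset_coe
    -- A basic neighbourhood of `P` is a finite intersection of subbasic sets; each of these meets
    -- `S`, hence so does the intersection.
    have := isIrreducible_iff_sInter.1 hS F (fun u hu => TopologicalSpace.isOpen_generateFrom_of_mem (hFs hu)) ?_
    · rwa [inter_comm]
    · intro u hu
      obtain ⟨U, hU, rfl⟩ := hFs hu
      obtain ⟨a, ha, haU⟩ := hPF _ hu
      obtain ⟨b, hbU, hb⟩ := mem_closure_iff.1 ((hP a).1 ha) U hU haU
      obtain ⟨Q, hQ, hbQ⟩ := mem_iUnion₂.1 hb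
      exact ⟨Q, hQ, b, hbQ, hbU⟩
  · intro Q hQ
    refine le_iff_mem_closure.1 fun a ha => ?_
    exact subset_closure (mem_iUnion₂.2 ⟨Q, hQ, ha⟩)

theorem continuous_sup : Continuous fun p : MaxSpace A × MaxSpace A => p.1 ⊔ p.2 := by
  refine continuous_iff_le_lowerLimit.2 fun p => sup_le ?_ ?_
  · exact (tendsto_nhds.1 (continuous_fst.tendsto p)).trans (lowerLimit_mono fun x => le_sup_left)
  · exact (tendsto_nhds.1 (continuous_snd.tendsto p)).trans (lowerLimit_mono fun x => le_sup_right)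

theorem continuous_mul : Continuous fun p : MaxSpace A × MaxSpace A => p.1 * p.2 := by
  refine continuous_iff_le_lowerLimit.2 fun p => mul_le.2 fun a ha b hb U hU => ?_
  have h1 : ∀ᶠ q : A × A in 𝓝 a ×ˢ 𝓝 b, q.1 * q.2 ∈ U := by
    rw [← nhds_prod_eq]
    exact (_root_.continuous_mul.tendsto (a, b)).eventually hU
  obtain ⟨V, hV, W, hW, h⟩ := mem_prod_iff.1 h1
  filter_upwards [(continuous_fst.tendsto p).eventually (eventually_inter_nonempty ha hV),
    (continuous_snd.tendsto p).eventually (eventually_inter_nonempty hb hW)]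
  rintro x ⟨v, hv, hv'⟩ ⟨w, hw, hw'⟩
  exact ⟨v * w, mul_mem_mul hv hw, h (mk_mem_prod hv' hw')⟩

theorem continuous_star : Continuous fun P : MaxSpace A => star P := by
  refine continuous_iff_le_lowerLimit.2 fun P a ha U hU => ?_
  have h1 : star ⁻¹' U ∈ 𝓝 (star a) :=
    ContinuousStar.continuous_star.continuousAt.preimage_mem_nhds (by rwa [star_star])
  filter_upwards [eventually_inter_nonempty (mem_star.1 ha) h1]
  rintro Q ⟨v, hv, hv'⟩
  exact ⟨star v, star_mem_star hv, hv'⟩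

protected theorem star_star (P : MaxSpace A) : star (star P) = P :=
  SetLike.ext fun a => by rw [mem_star, mem_star, star_star]

theorem star_mono {P Q : MaxSpace A} (h : P ≤ Q) : star P ≤ star Q := fun _ ha => h ha

/-- Dividing by a fixed element turns each inclusion into one between closed subspaces, where only
products of elements need to be tested. -/
protected theorem mul_assoc (P Q R : MaxSpace A) : P * Q * R = P * (Q * R) := by
  refine le_antisymm (mul_le.2 fun x hx c hc => ?_) (mul_le.2 fun a ha x hx => ?_)
  · refine mem_rightDiv.1 ((mul_le.2 fun a ha b hb => ?_ : P * Q ≤ rightDiv (P * (Q * R)) c) hx)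
    rw [mem_rightDiv, mul_assoc]
    exact mul_mem_mul ha (mul_mem_mul hb hc)
  · refine mem_leftDiv.1 ((mul_le.2 fun b hb c hc => ?_ : Q * R ≤ leftDiv (P * Q * R) a) hx)
    rw [mem_leftDiv, ← mul_assoc]
    exact mul_mem_mul (mul_mem_mul ha hb) hc

protected theorem mul_bot (P : MaxSpace A) : P * ⊥ = ⊥ := by
  refine le_bot_iff.1 (mul_le.2 fun a _ b hb => ?_)
  rw [mem_bot.1 hb, mul_zero]
  exact zero_mem _

theorem mul_mono_right (P : MaxSpace A) {Q R : MaxSpace A} (h : Q ≤ R) : P * Q ≤ P * R :=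
  mul_le.2 fun _ ha _ hb => mul_mem_mul ha (h hb)

protected theorem mul_sup (P Q R : MaxSpace A) : P * (Q ⊔ R) = P * Q ⊔ P * R := by
  refine le_antisymm (mul_le.2 fun a ha x hx => ?_)
    (sup_le (mul_mono_right P le_sup_left) (mul_mono_right P le_sup_right))
  have h1 : P * Q ≤ P * Q ⊔ P * R := le_sup_left
  have h2 : P * R ≤ P * Q ⊔ P * R := le_sup_right
  have h : Q ⊔ R ≤ leftDiv (P * Q ⊔ P * R) a :=
    sup_le (fun b hb => h1 (mul_mem_mul ha hb)) (fun b hb => h2 (mul_mem_mul ha hb))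
  exact h hx

theorem star_mul_le (P Q : MaxSpace A) : star (P * Q) ≤ star Q * star P := by
  have : P * Q ≤ star (star Q * star P) := mul_le.2 fun a ha b hb => by
    rw [mem_star, star_mul]
    exact mul_mem_mul (star_mem_star hb) (star_mem_star ha)
  simpa only [MaxSpace.star_star] using star_mono this

protected theorem star_mul (P Q : MaxSpace A) : star (P * Q) = star Q * star P := by
  refine le_antisymm (star_mul_le P Q) ?_
  have := star_mono (star_mul_le (star Q) (star P))
  simpa only [MaxSpace.star_star] using this

/-- The elements multiplying `P` into `W` from the right, together with their adjoints, form a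
closed *-algebra containing `a* a`, hence all its functional calculus. The approximation `a f(a* a)`
of `a` therefore stays in the closed subspace `W`. -/
theorem le_mul_star_mul {P : MaxSpace A} (hP : P * star P * P ≤ P) : P ≤ P * star P * P := by
  set W := P * star P * P with hW
  -- Real scalars suffice, because the functional calculus applied below is that of real functions.
  let B : NonUnitalStarSubalgebra ℝ A :=
    { carrier := {c | (∀ a ∈ P, a * c ∈ W) ∧ ∀ a ∈ P, a * star c ∈ W}
      add_mem' := by
        rintro c c' ⟨h1, h2⟩ ⟨h1', h2'⟩
        refine ⟨fun a ha => ?_, fun a ha => ?_⟩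
        · rw [mul_add]; exact add_mem (h1 a ha) (h1' a ha)
        · rw [star_add, mul_add]; exact add_mem (h2 a ha) (h2' a ha)
      zero_mem' := by simp
      mul_mem' := by
        rintro c c' ⟨h1, h2⟩ ⟨h1', h2'⟩
        refine ⟨fun a ha => ?_, fun a ha => ?_⟩
        -- The hypothesis enters here: `a * c` lies in `W ≤ P`, so it may be multiplied by `c'`
        -- again.
        · rw [← mul_assoc]; exact h1' _ (hP (h1 a ha))
        · rw [star_mul, ← mul_assoc]; exact h2 _ (hP (h2' a ha))
      smul_mem' := by
        rintro r c ⟨h1, h2⟩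
        refine ⟨fun a ha => ?_, fun a ha => ?_⟩
        · rw [mul_smul_comm, ← Complex.coe_smul]; exact SMulMemClass.smul_mem _ (h1 a ha)
        · rw [star_smul, mul_smul_comm, star_trivial, ← Complex.coe_smul]
          exact SMulMemClass.smul_mem _ (h2 a ha)
      star_mem' := by
        rintro c ⟨h1, h2⟩
        exact ⟨h2, by simpa using h1⟩ }
  have hB : IsClosed (B : Set A) := by
    have : (B : Set A) = ⋂ a ∈ P, ((fun c => a * c) ⁻¹' W ∩ (fun c => a * star c) ⁻¹' W) := by
      ext c
      simp only [mem_iInter, mem_inter_iff, mem_preimage]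
      exact ⟨fun h a ha => ⟨h.1 a ha, h.2 a ha⟩, fun h => ⟨fun a ha => (h a ha).1, fun a ha => (h a ha).2⟩⟩
    rw [this]
    refine isClosed_biInter fun a _ => IsClosed.inter ?_ ?_
    · exact W.isClosed.preimage (by fun_prop)
    · exact W.isClosed.preimage (by fun_prop)
  intro a ha
  have hb : star a * a ∈ B := by
    have h1 : ∀ v ∈ P, v * (star a * a) ∈ W := fun v hv => by
      rw [← mul_assoc]
      exact mul_mem_mul (mul_mem_mul hv (star_mem_star ha)) ha
    exact ⟨h1, by simpa using h1⟩
  change a ∈ (W : Set A)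
  rw [← W.isClosed.closure_eq]
  refine Metric.mem_closure_iff.2 fun ε hε => ?_
  -- The lemma bounds the square of the error; this tolerance makes the error at most `ε / 2 < ε`.
  obtain ⟨f, hf⟩ := exists_cfcₙ_mul_near a (ε := (ε / 2) ^ 2) (by positivity)
  have hfB : cfcₙ f (star a * a) ∈ B := cfcₙ_mem f hb
  refine ⟨_, hfB.1 a ha, ?_⟩
  rw [dist_eq_norm]
  have := le_of_sq_le_sq hf (by positivity)
  linarith

theorem isMeasurementSpace (A : Type*) [NonUnitalCStarAlgebra A] :
    IsMeasurementSpace (MaxSpace A) where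
  t0Space := ⟨fun _ _ h => le_antisymm
    (le_iff_mem_closure.2 (specializes_iff_mem_closure.1 h.specializes'))
    (le_iff_mem_closure.2 (specializes_iff_mem_closure.1 h.specializes))⟩
  quasiSober := ⟨fun hS hc => exists_isGenericPoint hS hc⟩
  le_iff_mem_closure := fun _ _ => le_iff_mem_closure
  continuous_sup := continuous_sup
  continuous_mul := continuous_mul
  continuous_star := continuous_star
  mul_assoc := MaxSpace.mul_assoc
  mul_bot := MaxSpace.mul_bot
  mul_sup := MaxSpace.mul_sup
  star_star := MaxSpace.star_star
  star_mul := MaxSpace.star_mul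
  stablyGelfand := fun _ => le_mul_star_mul

end MaxSpace

/-! ### Further groupoid identities -/

namespace TopologicalGroupoid
variable {G₀ G₁ : Type*} [TopologicalSpace G₀] [TopologicalSpace G₁]

/-- Multiplication carries a proof of composability, which must be transported along with its
arguments. -/
theorem mul_congr (G : TopologicalGroupoid G₀ G₁) {g g' h h' : G₁} (hg : g = g') (hh : h = h')
    (w : G.d g = G.r h) : G.mul g h w = G.mul g' h' (by rw [← hg, ← hh, w]) := by
  subst hg hh
  rfl

/-- Cancelling in `(gh)⁻¹ ((gh) h⁻¹)` gives `(gh)⁻¹ g = h⁻¹`; then multiply by `g⁻¹` on the right.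
-/
theorem inv_mul_rev (G : TopologicalGroupoid G₀ G₁) (g h : G₁) (w : G.d g = G.r h) :
    G.inv (G.mul g h w) = G.mul (G.inv h) (G.inv g) (by rw [G.d_inv, G.r_inv, w]) := by
  have h1 := G.inv_mul_cancel_left (G.mul g h w) (G.inv h) (by rw [G.d_mul, G.r_inv])
  have h2 := G.mul_congr rfl (G.mul_inv_cancel_right g h w)
    (show G.d (G.inv (G.mul g h w)) = _ by rw [G.d_inv, G.r_mul, G.r_mul, G.r_mul])
  have h3 := G.mul_inv_cancel_right (G.inv (G.mul g h w)) g (by rw [G.d_inv, G.r_mul])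
  rw [← h3]
  exact G.mul_congr (h2.symm.trans h1) rfl _

theorem mul_of_eq_u (G : TopologicalGroupoid G₀ G₁) (g : G₁) {e : G₁} (w : G.d g = G.r e)
    {x : G₀} (he : u G x = e) : G.mul g e w = g := by
  subst he
  rw [G.r_u] at w
  subst w
  exact G.mul_u g

theorem of_eq_u_mul (G : TopologicalGroupoid G₀ G₁) (g : G₁) {e : G₁} (w : G.d e = G.r g)
    {x : G₀} (he : u G x = e) : G.mul e g w = g := by
  subst he
  rw [G.d_u] at w
  subst w
  exact G.u_mul g

end TopologicalGroupoid

/-! ### Open sets of arrows: an inverse quantal frame and a classical measurement space -/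

namespace EtaleGroupoid
variable {G₀ G₁ : Type*} [TopologicalSpace G₀] [TopologicalSpace G₁]

/-- A continuous section of a local homeomorphism is a local homeomorphism. It makes the set of
units an element of the quantale. -/
theorem isOpenMap_u (G : EtaleGroupoid G₀ G₁) : IsOpenMap G.u := by
  refine (IsLocalHomeomorph.of_comp (g := G.d) ?_ G.isLocalHomeomorph_d G.continuous_u).isOpenMap
  rw [show G.d ∘ G.u = id from funext G.d_u]
  exact (Homeomorph.refl G₀).isLocalHomeomorph

namespace OpensSpace

variable {G : EtaleGroupoid G₀ G₁} {X : Type*}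

open Filter

instance : IsScott G.OpensSpace univ := ⟨rfl⟩

protected theorem isOpen (U : G.OpensSpace) : IsOpen (U : Set G₁) := TopologicalSpace.Opens.isOpen U

theorem mem_bot {x : G₁} : x ∈ (⊥ : G.OpensSpace) ↔ False := Iff.rfl

theorem mem_top (x : G₁) : x ∈ (⊤ : G.OpensSpace) := trivial

theorem mem_sup {U V : G.OpensSpace} {x : G₁} : x ∈ U ⊔ V ↔ x ∈ U ∨ x ∈ V := Iff.rfl

theorem mem_inf {U V : G.OpensSpace} {x : G₁} : x ∈ U ⊓ V ↔ x ∈ U ∧ x ∈ V := Iff.rfl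

theorem mem_sSup {S : Set G.OpensSpace} {x : G₁} : x ∈ sSup S ↔ ∃ U ∈ S, x ∈ U :=
  TopologicalSpace.Opens.mem_sSup

theorem mem_biSup {S : Set G.OpensSpace} {f : G.OpensSpace → G.OpensSpace} {x : G₁} :
    x ∈ ⨆ U ∈ S, f U ↔ ∃ U ∈ S, x ∈ f U := by
  rw [← sSup_image, mem_sSup, exists_mem_image]

theorem mem_mul {U V : G.OpensSpace} {x : G₁} :
    x ∈ U * V ↔ ∃ y ∈ U, ∃ z ∈ V, ∃ w : G.d y = G.r z, G.mul y z w = x := by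
  constructor
  · rintro ⟨⟨⟨y, z⟩, w⟩, ⟨hy, hz⟩, rfl⟩
    exact ⟨y, hy, z, hz, w, rfl⟩
  · rintro ⟨y, hy, z, hz, w, rfl⟩
    exact ⟨⟨⟨y, z⟩, w⟩, ⟨hy, hz⟩, rfl⟩

theorem mul_mem_mul {U V : G.OpensSpace} {y z : G₁} (hy : y ∈ U) (hz : z ∈ V)
    (w : G.d y = G.r z) : G.mul y z w ∈ U * V :=
  mem_mul.2 ⟨y, hy, z, hz, w, rfl⟩

theorem mul_mono {U U' V V' : G.OpensSpace} (hU : U ≤ U') (hV : V ≤ V') : U * V ≤ U' * V' := by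
  intro x hx
  obtain ⟨y, hy, z, hz, w, rfl⟩ := mem_mul.1 hx
  exact mul_mem_mul (hU hy) (hV hz) w

theorem mem_star {U : G.OpensSpace} {x : G₁} : x ∈ star U ↔ G.inv x ∈ U := Iff.rfl

/-- The open set of units. -/
def units (G : EtaleGroupoid G₀ G₁) : G.OpensSpace := ⟨range G.u, G.isOpenMap_u.isOpen_range⟩

theorem isMulUnit_units : IsMulUnit (units G) := by
  refine fun q => ⟨SetLike.ext fun x => ?_, SetLike.ext fun x => ?_⟩
  · rw [mem_mul]
    constructor
    · rintro ⟨y, ⟨s, hs⟩, z, hz, w, rfl⟩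
      rwa [G.of_eq_u_mul z w hs]
    · exact fun hx => ⟨_, ⟨G.r x, rfl⟩, x, hx, _, G.u_mul x⟩
  · rw [mem_mul]
    constructor
    · rintro ⟨y, hy, z, ⟨s, hs⟩, w, rfl⟩
      rwa [G.mul_of_eq_u y w hs]
    · exact fun hx => ⟨x, hx, _, ⟨G.d x, rfl⟩, _, G.mul_u x⟩

theorem eq_units_of_isMulUnit {e : G.OpensSpace} (he : IsMulUnit e) : e = units G := by
  rw [← (he (units G)).1, (isMulUnit_units e).2]

/-- If `y` and `z` in `U` have the same domain, then `y z⁻¹` lies in `U U*` and so is a unit, and `y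
= (y z⁻¹) z = z`. -/
theorem injOn_d_of_mem_partialUnits {U : G.OpensSpace} (hU : U ∈ partialUnits G.OpensSpace) :
    InjOn G.d U := by
  obtain ⟨e, he, h, -⟩ := hU
  rw [eq_units_of_isMulUnit he] at h
  intro y hy z hz hyz
  have hz' : G.inv z ∈ star U := by rwa [mem_star, G.inv_inv]
  obtain ⟨s, hs⟩ := h (mul_mem_mul hy hz' (by rw [G.r_inv, hyz]))
  have h1 := G.inv_mul_cancel_right y z hyz
  rw [← h1]
  exact G.of_eq_u_mul z _ hs

theorem mul_star_le_units {U : G.OpensSpace} (hU : InjOn G.d U) : U * star U ≤ units G := by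
  intro x hx
  obtain ⟨y, hy, z, hz, w, rfl⟩ := mem_mul.1 hx
  have h1 : y = G.inv z := hU hy hz (by rw [w, G.d_inv])
  refine ⟨G.r y, ?_⟩
  rw [← G.mul_inv y]
  exact G.mul_congr rfl (by rw [h1, G.inv_inv]) _

theorem star_mul_le_units {U : G.OpensSpace} (hU : InjOn G.r U) : star U * U ≤ units G := by
  intro x hx
  obtain ⟨y, hy, z, hz, w, rfl⟩ := mem_mul.1 hx
  have h1 : G.inv y = z := hU hy hz (by rw [G.r_inv, w])
  refine ⟨G.d z, ?_⟩
  rw [← G.inv_mul z]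
  exact G.mul_congr (by rw [← h1, G.inv_inv]) rfl _

theorem mem_partialUnits {U : G.OpensSpace} (hd : InjOn G.d U) (hr : InjOn G.r U) :
    U ∈ partialUnits G.OpensSpace :=
  ⟨units G, isMulUnit_units, mul_star_le_units hd, star_mul_le_units hr⟩

/-- Domain and range are both local homeomorphisms, so their charts at `x` can be intersected.
Bisections provide the partial units that cover the arrows, and the sets on which convolution sums
collapse. -/
theorem exists_bisection {U : G.OpensSpace} {x : G₁} (hx : x ∈ U) :
    ∃ V : G.OpensSpace, V ≤ U ∧ x ∈ V ∧ InjOn G.d V ∧ InjOn G.r V := by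
  obtain ⟨e, he, hed⟩ := G.isLocalHomeomorph_d x
  obtain ⟨f, hf, hfr⟩ := G.isLocalHomeomorph_r x
  refine ⟨⟨U ∩ (e.source ∩ f.source), U.isOpen.inter (e.open_source.inter f.open_source)⟩,
    fun y hy => hy.1, ⟨hx, he, hf⟩, ?_, ?_⟩
  · rw [hed]
    exact e.injOn.mono fun y hy => hy.2.1
  · rw [hfr]
    exact f.injOn.mono fun y hy => hy.2.2

protected theorem mul_assoc (U V W : G.OpensSpace) : U * V * W = U * (V * W) := by
  refine SetLike.ext fun x => ?_
  simp only [mem_mul]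
  constructor
  · rintro ⟨_, ⟨a, ha, b, hb, w, rfl⟩, c, hc, w', rfl⟩
    rw [G.d_mul] at w'
    exact ⟨a, ha, _, ⟨b, hb, c, hc, w', rfl⟩, by rw [G.r_mul, w], G.mul_assoc a b c w w'⟩
  · rintro ⟨a, ha, _, ⟨b, hb, c, hc, w', rfl⟩, w, rfl⟩
    rw [G.r_mul] at w
    exact ⟨_, ⟨a, ha, b, hb, w, rfl⟩, c, hc, by rw [G.d_mul, w'], (G.mul_assoc a b c w w').symm⟩

protected theorem mul_sSup (U : G.OpensSpace) (S : Set G.OpensSpace) :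
    U * sSup S = ⨆ V ∈ S, U * V := by
  refine SetLike.ext fun x => ?_
  simp only [mem_mul, mem_biSup, mem_sSup]
  grind

protected theorem sSup_mul (S : Set G.OpensSpace) (U : G.OpensSpace) :
    sSup S * U = ⨆ V ∈ S, V * U := by
  refine SetLike.ext fun x => ?_
  simp only [mem_mul, mem_biSup, mem_sSup]
  grind

protected theorem mul_bot (U : G.OpensSpace) : U * ⊥ = ⊥ := by
  rw [← sSup_empty, OpensSpace.mul_sSup]
  simp

protected theorem mul_sup (U V W : G.OpensSpace) : U * (V ⊔ W) = U * V ⊔ U * W := by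
  rw [← sSup_pair, OpensSpace.mul_sSup, iSup_pair]

protected theorem star_star (U : G.OpensSpace) : star (star U) = U :=
  SetLike.ext fun x => by rw [mem_star, mem_star, G.inv_inv]

protected theorem star_mul (U V : G.OpensSpace) : star (U * V) = star V * star U := by
  refine SetLike.ext fun x => ?_
  rw [mem_star, mem_mul, mem_mul]
  constructor
  · rintro ⟨y, hy, z, hz, w, hx⟩
    refine ⟨G.inv z, by rwa [mem_star, G.inv_inv], G.inv y, by rwa [mem_star, G.inv_inv],
      by rw [G.d_inv, G.r_inv, w], ?_⟩
    rw [← G.inv_mul_rev y z w, hx, G.inv_inv]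
  · rintro ⟨y, hy, z, hz, w, rfl⟩
    exact ⟨G.inv z, hz, G.inv y, hy, _, (G.inv_mul_rev y z w).symm⟩

protected theorem star_sSup (S : Set G.OpensSpace) : star (sSup S) = ⨆ U ∈ S, star U := by
  refine SetLike.ext fun x => ?_
  simp only [mem_star, mem_biSup, mem_sSup]

protected theorem inf_sSup (U : G.OpensSpace) (S : Set G.OpensSpace) :
    U ⊓ sSup S = ⨆ V ∈ S, U ⊓ V := by
  refine SetLike.ext fun x => ?_
  simp only [mem_inf, mem_biSup, mem_sSup]
  grind

theorem le_mul_star_mul (U : G.OpensSpace) : U ≤ U * star U * U := by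
  intro x hx
  have hx' : G.inv x ∈ star U := by rwa [mem_star, G.inv_inv]
  have h := mul_mem_mul (mul_mem_mul hx hx' (G.r_inv x).symm) hx (by rw [G.d_mul, G.d_inv])
  rwa [G.of_eq_u_mul x _ (G.mul_inv x).symm] at h

theorem isInverseQuantalFrame (G : EtaleGroupoid G₀ G₁) : IsInverseQuantalFrame G.OpensSpace where
  mul_assoc := OpensSpace.mul_assoc
  mul_sSup := OpensSpace.mul_sSup
  sSup_mul := OpensSpace.sSup_mul
  star_star := OpensSpace.star_star
  star_mul := OpensSpace.star_mul
  star_sSup := OpensSpace.star_sSup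
  exists_unit := ⟨units G, isMulUnit_units⟩
  stablyGelfand := fun U _ => le_mul_star_mul U
  inf_sSup := OpensSpace.inf_sSup
  sSup_partialUnits := by
    refine top_le_iff.1 fun x hx => mem_sSup.2 ?_
    obtain ⟨V, -, hxV, hd, hr⟩ := exists_bisection hx
    exact ⟨V, mem_partialUnits hd hr, hxV⟩

theorem exists_subset_of_directedOn {K : Set G₁} (hK : IsCompact K) {D : Set G.OpensSpace}
    (hne : D.Nonempty) (hD : DirectedOn (· ≤ ·) D) (h : K ⊆ (sSup D : G.OpensSpace)) :
    ∃ V ∈ D, K ⊆ V := by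
  have : Nonempty D := hne.to_subtype
  obtain ⟨V, hV⟩ := hK.elim_directed_cover (fun V : D => ((V : G.OpensSpace) : Set G₁))
    (fun V => V.1.isOpen)
    (fun x hx => by
      obtain ⟨V, hV, hxV⟩ := mem_sSup.1 (h hx)
      exact mem_iUnion.2 ⟨⟨V, hV⟩, hxV⟩)
    (fun V W => by
      obtain ⟨Z, hZ, h1, h2⟩ := hD V V.2 W W.2
      exact ⟨⟨Z, hZ⟩, h1, h2⟩)
  exact ⟨V, V.2, hV⟩

theorem isOpen_setOf_subset {K : Set G₁} (hK : IsCompact K) :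
    IsOpen {U : G.OpensSpace | K ⊆ U} := by
  refine (IsScott.isOpen_iff_isUpperSet_and_dirSupInaccOn (D := univ)).2
    ⟨fun U V h hU x hx => h (hU hx), ?_⟩
  intro D _ hne hD U hU hKU
  rw [← hU.sSup_eq] at hKU
  exact exists_subset_of_directedOn hK hne hD hKU

variable [LocallyCompactSpace G₁]

theorem isLUB_interior (U : G.OpensSpace) :
    IsLUB {V : G.OpensSpace | ∃ K : Set G₁, IsCompact K ∧ K ⊆ U ∧ interior K = V} U := by
  constructor
  · rintro V ⟨K, -, hKU, hV⟩ x hx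
    exact hKU (interior_subset (hV.symm ▸ hx : x ∈ interior K))
  · intro W hW x hx
    obtain ⟨K, hK, hKx, hKU⟩ := exists_compact_subset U.isOpen hx
    exact hW (show (⟨interior K, isOpen_interior⟩ : G.OpensSpace) ∈ _ from ⟨K, hK, hKU, rfl⟩) hKx

/-- By local compactness `U` is the directed join of the interiors of its compact subsets, so one of
these interiors is already in the Scott open set. With `isOpen_setOf_subset`, the sets `{V | K ⊆ V}`
for compact `K` form a basis of the Scott topology. -/
theorem exists_compact_of_mem_isOpen {S : Set G.OpensSpace} (hS : IsOpen S) {U : G.OpensSpace}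
    (hU : U ∈ S) : ∃ K : Set G₁, IsCompact K ∧ K ⊆ U ∧ ∀ V : G.OpensSpace, K ⊆ V → V ∈ S := by
  obtain ⟨h1, h2⟩ := (IsScott.isOpen_iff_isUpperSet_and_dirSupInaccOn (D := univ)).1 hS
  obtain ⟨V, ⟨K, hK, hKU, hV⟩, hVS⟩ := h2 (mem_univ
    {V : G.OpensSpace | ∃ K : Set G₁, IsCompact K ∧ K ⊆ U ∧ interior K = V})
    ⟨⟨interior ∅, isOpen_interior⟩, ∅, isCompact_empty, empty_subset _, rfl⟩ (by
      rintro V ⟨K, hK, hKU, hV⟩ W ⟨L, hL, hLU, hW⟩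
      refine ⟨⟨interior (K ∪ L), isOpen_interior⟩, ⟨_, hK.union hL, union_subset hKU hLU, rfl⟩,
        ?_, ?_⟩
      · change (V : Set G₁) ⊆ interior (K ∪ L)
        rw [← hV]
        exact interior_mono subset_union_left
      · change (W : Set G₁) ⊆ interior (K ∪ L)
        rw [← hW]
        exact interior_mono subset_union_right) (isLUB_interior U) hU
  refine ⟨K, hK, hKU, fun W hKW => h1 (fun x hx => hKW ?_) hVS⟩
  exact interior_subset (hV.symm ▸ hx : x ∈ interior K)

theorem isOpen_setOf_mem : IsOpen {p : G.OpensSpace × G₁ | p.2 ∈ p.1} := by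
  refine isOpen_iff_mem_nhds.2 fun ⟨U, x⟩ hx => ?_
  obtain ⟨K, hK, hKx, hKU⟩ := exists_compact_subset U.isOpen hx
  filter_upwards [prod_mem_nhds ((isOpen_setOf_subset hK).mem_nhds hKU)
    (isOpen_interior.mem_nhds hKx)]
  rintro ⟨V, y⟩ ⟨hV, hy⟩
  exact hV (interior_subset hy)

/-- The membership relation is itself open, and pulls back along a continuous `f`. Conversely, the
tube lemma for a compact `K ⊆ f x` gives `K ⊆ f z` for all `z` near `x`, and such `K` determine the
neighbourhoods of `f x`. -/
theorem continuous_iff_isOpen [TopologicalSpace X] {f : X → G.OpensSpace} :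
    Continuous f ↔ IsOpen {p : X × G₁ | p.2 ∈ f p.1} := by
  constructor
  · intro h
    exact isOpen_setOf_mem.preimage (h.prodMap continuous_id)
  · intro h
    refine continuous_iff_continuousAt.2 fun x => ?_
    intro N hN
    obtain ⟨S, hSN, hS, hxS⟩ := mem_nhds_iff.1 hN
    obtain ⟨K, hK, hKx, hKS⟩ := exists_compact_of_mem_isOpen hS hxS
    have := hK.eventually_forall_of_forall_eventually (x₀ := x) (P := fun x y => y ∈ f x)
      fun y hy => h.mem_nhds (hKx hy)
    exact this.mono fun z hz => hSN (hKS _ hz)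

theorem continuous_sup : Continuous fun p : G.OpensSpace × G.OpensSpace => p.1 ⊔ p.2 := by
  rw [continuous_iff_isOpen]
  exact (continuous_iff_isOpen.1 continuous_fst).union (continuous_iff_isOpen.1 continuous_snd)

theorem continuous_star : Continuous fun U : G.OpensSpace => star U := by
  rw [continuous_iff_isOpen]
  exact isOpen_setOf_mem.preimage (continuous_id.prodMap G.continuous_inv)

/-- The membership relation of the product is the image of an open set under `id × mulMap`, which is
an open map because the multiplication of an étale groupoid is a local homeomorphism. -/
theorem continuous_mul : Continuous fun p : G.OpensSpace × G.OpensSpace => p.1 * p.2 := by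
  rw [continuous_iff_isOpen]
  have h1 : IsOpen {q : (G.OpensSpace × G.OpensSpace) × G.Comp | q.2.1.1 ∈ q.1.1} :=
    isOpen_setOf_mem.preimage (f := fun q : (G.OpensSpace × G.OpensSpace) × G.Comp =>
      (q.1.1, q.2.1.1)) (by fun_prop)
  have h2 : IsOpen {q : (G.OpensSpace × G.OpensSpace) × G.Comp | q.2.1.2 ∈ q.1.2} :=
    isOpen_setOf_mem.preimage (f := fun q : (G.OpensSpace × G.OpensSpace) × G.Comp =>
      (q.1.2, q.2.1.2)) (by fun_prop)
  convert (IsOpenMap.id.prodMap G.isLocalHomeomorph_mulMap.isOpenMap) _ (h1.inter h2)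
  ext ⟨⟨U, V⟩, x⟩
  constructor
  · rintro ⟨p, hp, rfl⟩
    exact ⟨((U, V), p), hp, rfl⟩
  · rintro ⟨⟨UV, p⟩, hp, h⟩
    obtain ⟨rfl, rfl⟩ := Prod.mk.inj h
    exact ⟨p, hp, rfl⟩

/-- A Scott closed set is a lower set closed under directed joins, so it suffices to write `sSup S`
as a directed join of members of `S`: then `S` is the principal ideal of `sSup S`. -/
theorem exists_isGenericPoint {S : Set G.OpensSpace} (hS : IsIrreducible S) (hc : IsClosed S) :
    ∃ U, IsGenericPoint U S := by
  obtain ⟨hlow, hdir⟩ := IsScott.isClosed_iff_isLowerSet_and_dirSupClosed.1 hc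
  -- `S` is not known to be directed, but these compact approximations of its members are.
  let D : Set G.OpensSpace := {V | ∃ K : Set G₁, IsCompact K ∧ interior K = V ∧ ∃ U ∈ S, K ⊆ U}
  have hDS : D ⊆ S := by
    rintro V ⟨K, -, hV, U, hU, hKU⟩
    exact hlow (fun x hx => hKU (interior_subset (hV.symm ▸ hx : x ∈ interior K))) hU
  have hDne : D.Nonempty := by
    obtain ⟨U, hU⟩ := hS.1
    exact ⟨⟨interior ∅, isOpen_interior⟩, ∅, isCompact_empty, rfl, U, hU, empty_subset _⟩
  have hDd : DirectedOn (· ≤ ·) D := by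
    rintro V ⟨K, hK, hV, U, hU, hKU⟩ W ⟨L, hL, hW, U', hU', hLU⟩
    -- Containing `K` and containing `L` are Scott open conditions, so irreducibility yields one
    -- member of `S` containing both.
    obtain ⟨Z, hZ, hZK, hZL⟩ := hS.2 _ _ (isOpen_setOf_subset hK) (isOpen_setOf_subset hL)
      ⟨U, hU, hKU⟩ ⟨U', hU', hLU⟩
    refine ⟨⟨interior (K ∪ L), isOpen_interior⟩, ⟨_, hK.union hL, rfl, Z, hZ,
      union_subset hZK hZL⟩, ?_, ?_⟩
    · change (V : Set G₁) ⊆ interior (K ∪ L)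
      rw [← hV]
      exact interior_mono subset_union_left
    · change (W : Set G₁) ⊆ interior (K ∪ L)
      rw [← hW]
      exact interior_mono subset_union_right
  have hlub : IsLUB D (sSup S) := by
    refine ⟨fun V hV => le_sSup (hDS hV), fun W hW => sSup_le fun U hU => ?_⟩
    refine (isLUB_interior U).2 ?_
    rintro V ⟨K, hK, hKU, hV⟩
    exact hW ⟨K, hK, hV, U, hU, hKU⟩
  refine ⟨sSup S, ?_⟩
  rw [IsGenericPoint, IsScott.closure_singleton]
  exact Subset.antisymm (fun U hU => hlow hU (hdir hDS hDne hDd hlub)) fun U hU => le_sSup hU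

/-- A basic open set inside a compact subset of `U` is way below `U`, and such sets cover `U` by
local compactness. -/
theorem exists_countable_basis [SecondCountableTopology G₁] (G : EtaleGroupoid G₀ G₁) :
    ∃ B : Set G.OpensSpace, B.Countable ∧ ∀ U : G.OpensSpace, IsLUB {b ∈ B | WayBelow b U} U := by
  have hb := TopologicalSpace.isBasis_countableBasis G₁
  let B : Set G.OpensSpace := {V | (V : Set G₁) ∈ TopologicalSpace.countableBasis G₁}
  refine ⟨B, (TopologicalSpace.countable_countableBasis G₁).preimage SetLike.coe_injective, ?_⟩
  refine fun U => ⟨?_, fun W hW x hx => ?_⟩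
  · rintro V ⟨-, hV⟩
    -- The directed set `{U}` shows that way below implies below.
    obtain ⟨_, rfl, h⟩ := hV {U} (singleton_nonempty U) (directedOn_singleton U) (by simp)
    exact h
  · obtain ⟨K, hK, hKx, hKU⟩ := exists_compact_subset U.isOpen hx
    obtain ⟨V, hVB, hxV, hVK⟩ := hb.exists_subset_of_mem_open hKx isOpen_interior
    have h : (⟨V, hb.isOpen hVB⟩ : G.OpensSpace) ∈ {b ∈ B | WayBelow b U} := by
      refine ⟨hVB, fun D hne hD hU => ?_⟩
      obtain ⟨Z, hZ, hKZ⟩ := exists_subset_of_directedOn hK hne hD (hKU.trans hU)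
      exact ⟨Z, hZ, fun y hy => hKZ (interior_subset (hVK hy))⟩
    exact hW h hxV

theorem isMeasurementSpace (G : EtaleGroupoid G₀ G₁) : IsMeasurementSpace G.OpensSpace where
  t0Space := inferInstance
  quasiSober := ⟨fun hS hc => exists_isGenericPoint hS hc⟩
  le_iff_mem_closure := fun U V => by rw [IsScott.closure_singleton, mem_Iic]
  continuous_sup := continuous_sup
  continuous_mul := continuous_mul
  continuous_star := continuous_star
  mul_assoc := OpensSpace.mul_assoc
  mul_bot := OpensSpace.mul_bot
  mul_sup := OpensSpace.mul_sup
  star_star := OpensSpace.star_star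
  star_mul := OpensSpace.star_mul
  stablyGelfand := fun U _ => le_mul_star_mul U

theorem isClassicalMeasurementSpace [SecondCountableTopology G₁] (G : EtaleGroupoid G₀ G₁) :
    IsClassicalMeasurementSpace G.OpensSpace where
  toIsMeasurementSpace := isMeasurementSpace G
  inf_sSup := OpensSpace.inf_sSup
  exists_countable_basis := exists_countable_basis G
  isScott := inferInstance
  le_mul_star_mul := le_mul_star_mul

end OpensSpace

end EtaleGroupoid

/-! ### Supports of convolutions -/

namespace EtaleGroupoid
variable {G₀ G₁ : Type*} [TopologicalSpace G₀] [TopologicalSpace G₁]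

open scoped CompactlySupported

theorem kernel_unit_ne_zero (G : EtaleGroupoid G₀ G₁) {f : G₁ → ℂ} {z : G₁} {s : G₀}
    (h : G.kernel f z (G.u s) ≠ 0) : G.d z = s ∧ f z ≠ 0 := by
  have h1 : G.d z = s := by
    by_contra hne
    exact h (dif_neg (by rwa [G.d_u]))
  subst h1
  rw [G.kernel_unit] at h
  exact ⟨rfl, h⟩

/-- The only factorization of `x` whose second factor is a unit is `x = x u(d x)`. -/
theorem conv_eq_mul_of_support_units (G : EtaleGroupoid G₀ G₁) (f k : G₁ → ℂ)
    (hk : ∀ z, k z ≠ 0 → ∃ s, G.u s = z) (x : G₁) :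
    G.conv f k x = f x * k (G.u (G.d x)) := by
  rw [G.conv_eq_finsum_kernel, finsum_eq_single _ (G.u (G.d x)), G.kernel_unit]
  intro z hz
  by_contra h0
  obtain ⟨s, rfl⟩ := hk z (right_ne_zero_of_mul h0)
  apply hz
  by_cases h : G.d x = G.d (G.u s)
  · rw [h, G.d_u]
  · exact absurd (dif_neg h) (left_ne_zero_of_mul h0)

/-- The unit at `d z` factors as `y⁻¹ y` with `d y = d z`; injectivity of `d` on `S` leaves only `y
= z`. -/
theorem convStar_conv_self_unit (G : EtaleGroupoid G₀ G₁) {h : G₁ → ℂ} {S : Set G₁}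
    (hS : support h ⊆ S) (hd : InjOn G.d S) {z : G₁} (hz : z ∈ S) :
    G.conv (G.convStar h) h (G.u (G.d z)) = star (h z) * h z := by
  rw [G.conv_eq_finsum_kernel, finsum_eq_single _ z, G.kernel_convStar, G.kernel_unit]
  intro y hy
  by_contra h0
  apply hy
  refine hd (hS (right_ne_zero_of_mul h0)) hz ?_
  by_contra hne
  refine left_ne_zero_of_mul h0 (dif_neg ?_)
  rw [G.d_u]
  exact Ne.symm hne

section Support
variable [T2Space G₁]

/-- The product of the two supports is compact, hence closed, so taking the closure of the support
of the convolution does not leave it. -/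
theorem tsupport_convCc_subset [LocallyCompactSpace G₁] (G : EtaleGroupoid G₀ G₁) {f g : C_c(G₁, ℂ)} {U V : G.OpensSpace}
    (hf : tsupport f ⊆ U) (hg : tsupport g ⊆ V) :
    tsupport (G.convCc f g) ⊆ (U * V : G.OpensSpace) := by
  have := G.t2Space_objects
  have hcl : IsClosed {p : G₁ × G₁ | G.d p.1 = G.r p.2} :=
    isClosed_eq (G.continuous_d.comp continuous_fst) (G.continuous_r.comp continuous_snd)
  have h1 : IsCompact ((Subtype.val : G.Comp → G₁ × G₁) ⁻¹' (tsupport f ×ˢ tsupport g)) :=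
    hcl.isClosedEmbedding_subtypeVal.isCompact_preimage
      (f.hasCompactSupport.isCompact.prod g.hasCompactSupport.isCompact)
  have h2 : IsClosed (G.mulMap '' (Subtype.val ⁻¹' (tsupport f ×ˢ tsupport g))) :=
    (h1.image G.isLocalHomeomorph_mulMap.continuous).isClosed
  refine (h2.closure_subset_iff.2 fun x hx => ?_).trans
    (image_mono (f := G.mulMap) fun p hp => ⟨hf hp.1, hg hp.2⟩)
  by_contra h0
  refine hx (finsum_eq_zero_of_forall_eq_zero fun p => ?_)
  by_contra hp
  exact h0 ⟨p.1, ⟨subset_tsupport f (left_ne_zero_of_mul hp),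
    subset_tsupport g (right_ne_zero_of_mul hp)⟩, p.2⟩

theorem tsupport_starCc_subset (G : EtaleGroupoid G₀ G₁) {f : C_c(G₁, ℂ)} {U : G.OpensSpace}
    (hf : tsupport f ⊆ U) : tsupport (G.starCc f) ⊆ (star U : G.OpensSpace) := by
  have h2 : IsClosed (G.inv ⁻¹' tsupport f) := isClosed_closure.preimage G.continuous_inv
  refine (h2.closure_subset_iff.2 fun x hx => ?_).trans (preimage_mono (f := G.inv) hf)
  refine subset_tsupport f fun h0 => hx ?_
  change star (f (G.inv x)) = 0
  rw [h0, star_zero]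

end Support

end EtaleGroupoid

/-! ### Cutoffs and partitions of unity -/

section Cutoff

variable {X : Type*} [TopologicalSpace X] [T2Space X] [LocallyCompactSpace X]

open scoped CompactlySupported

theorem exists_cc_eq_one {K U : Set X} (hK : IsCompact K) (hU : IsOpen U) (h : K ⊆ U) :
    ∃ f : C_c(X, ℂ), tsupport f ⊆ U ∧ ∀ x ∈ K, f x = 1 := by
  -- A cutoff function is a partition of unity for a cover by one set.
  obtain ⟨ψ, h1, h2, -, h4⟩ := exists_continuous_sum_one_of_isOpen_isCompact
    (s := fun _ : Fin 1 => U) (fun _ => hU) hK (h.trans (subset_iUnion (fun _ : Fin 1 => U) 0))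
  have hs : support (fun x => (ψ 0 x : ℂ)) = support (ψ 0) := by
    ext x
    simp
  refine ⟨⟨⟨fun x => (ψ 0 x : ℂ), by fun_prop⟩, ?_⟩, ?_, fun x hx => ?_⟩
  · change IsCompact (closure (support fun x => (ψ 0 x : ℂ)))
    rw [hs]
    exact h4 0
  · change closure (support fun x => (ψ 0 x : ℂ)) ⊆ U
    rw [hs]
    exact h1 0
  · have := h2 hx
    simp only [Finset.univ_unique, Finset.sum_singleton, Pi.one_apply] at this
    change ((ψ 0 x : ℝ) : ℂ) = 1
    exact_mod_cast this

/-- A partition of unity on the compact support of `f` splits it into finitely many summands with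
small support. This makes compatibility of `closureCc` with joins and products a local matter. -/
theorem mem_of_locally_mem (S : Submodule ℂ C_c(X, ℂ)) (f : C_c(X, ℂ))
    (h : ∀ x ∈ tsupport f, ∃ V, IsOpen V ∧ x ∈ V ∧ ∀ g : C_c(X, ℂ), tsupport g ⊆ V → g ∈ S) :
    f ∈ S := by
  choose! V hV hxV hVS using h
  obtain ⟨t, htf, ht⟩ := f.hasCompactSupport.isCompact.elim_nhds_subcover V
    fun x hx => (hV x hx).mem_nhds (hxV x hx)
  let φ := t.equivFin
  have hφ : ∀ i, ((φ.symm i : t) : X) ∈ tsupport f := fun i => htf _ (φ.symm i).2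
  obtain ⟨ψ, h1, h2, -, -⟩ := exists_continuous_sum_one_of_isOpen_isCompact
    (s := fun i => V (φ.symm i)) (fun i => hV _ (hφ i)) f.hasCompactSupport.isCompact (by
      intro x hx
      obtain ⟨y, hy, hxy⟩ := mem_iUnion₂.1 (ht hx)
      exact mem_iUnion.2 ⟨φ ⟨y, hy⟩, by simpa using hxy⟩)
  let g : Fin t.card → C_c(X, ℂ) := fun i =>
    ⟨⟨fun x => (ψ i x : ℂ) * f x, by have := f.continuous; fun_prop⟩,
      f.hasCompactSupport.isCompact.of_isClosed_subset isClosed_closure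
        (closure_mono (support_mul_subset_right _ _))⟩
  have hg : f = ∑ i, g i := by
    ext x
    rw [CompactlySupportedContinuousMap.sum_apply]
    change f x = ∑ i, (ψ i x : ℂ) * f x
    by_cases hx : x ∈ tsupport f
    · have := h2 hx
      simp only [Finset.sum_apply, Pi.one_apply] at this
      rw [← Finset.sum_mul, ← Complex.ofReal_sum, this]
      simp
    · simp [image_eq_zero_of_notMem_tsupport hx]
  rw [hg]
  have hsupp : ∀ i, support (g i) ⊆ support (ψ i) := by
    intro i x hx h0
    apply hx
    change (ψ i x : ℂ) * f x = 0
    simp [h0]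
  exact S.sum_mem fun i _ => hVS _ (hφ i) _ ((closure_mono (hsupp i)).trans (h1 i))

end Cutoff

/-! ### The embedding of open sets is a homomorphism of measurement spaces -/

namespace EtaleGroupoid
variable {G₀ G₁ : Type*} [TopologicalSpace G₀] [TopologicalSpace G₁] [T2Space G₁]
  [LocallyCompactSpace G₁]

open scoped CompactlySupported

theorem toReduced_convCc (G : EtaleGroupoid G₀ G₁) (f g : C_c(G₁, ℂ)) :
    G.toReduced (G.convCc f g) = G.toReduced f * G.toReduced g :=
  Subtype.ext (G.regRep_mul f g)

theorem toReduced_starCc (G : EtaleGroupoid G₀ G₁) (f : C_c(G₁, ℂ)) :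
    G.toReduced (G.starCc f) = star (G.toReduced f) :=
  Subtype.ext (G.regRep_star f)

/-- Matrix coefficients recover the function. Associativity of convolution can thus be read off from
composition of operators. -/
theorem toReduced_injective (G : EtaleGroupoid G₀ G₁) : Injective G.toReduced := fun f g h =>
  DFunLike.coe_injective (by rw [← G.toFunction_toReduced f, h, G.toFunction_toReduced])

theorem convCc_assoc (G : EtaleGroupoid G₀ G₁) (f g h : C_c(G₁, ℂ)) :
    G.convCc (G.convCc f g) h = G.convCc f (G.convCc g h) :=
  G.toReduced_injective (by simp only [toReduced_convCc, mul_assoc])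

theorem denseRange_toReduced (G : EtaleGroupoid G₀ G₁) : DenseRange G.toReduced := by
  intro a
  refine Metric.mem_closure_iff.2 fun ε hε => ?_
  obtain ⟨_, ⟨f, rfl⟩, hf⟩ := Metric.mem_closure_iff.1 a.2 ε hε
  exact ⟨_, ⟨f, rfl⟩, hf⟩

section ClosureCc

variable {G : EtaleGroupoid G₀ G₁}

theorem toReduced_mem_closureCc {f : C_c(G₁, ℂ)} {U : G.OpensSpace} (hf : tsupport f ⊆ U) :
    G.toReduced f ∈ G.closureCc U :=
  subset_closure (Submodule.mem_map_of_mem (show f ∈ G.ccOn U from hf))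

theorem closureCc_le {U : G.OpensSpace} {P : MaxSpace G.ReducedCStarAlgebra} :
    G.closureCc U ≤ P ↔ ∀ f : C_c(G₁, ℂ), tsupport f ⊆ U → G.toReduced f ∈ P := by
  refine ⟨fun h f hf => h (toReduced_mem_closureCc hf), fun h => ?_⟩
  refine Submodule.closure_le.2 ?_
  rintro _ ⟨f, hf, rfl⟩
  exact h f hf

theorem closureCc_mono {U V : G.OpensSpace} (h : U ≤ V) : G.closureCc U ≤ G.closureCc V :=
  closureCc_le.2 fun _ hf => toReduced_mem_closureCc fun _ hx => h (hf hx)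

/-- If `f` is supported in `U`, its support is compact and so lies in every `V` near `U` in the
Scott topology; hence `f` itself belongs to all nearby values. -/
theorem continuous_closureCc : Continuous G.closureCc := by
  refine MaxSpace.continuous_iff_le_lowerLimit.2 fun U => closureCc_le.2 fun f hf N hN => ?_
  filter_upwards [(OpensSpace.isOpen_setOf_subset f.hasCompactSupport.isCompact).mem_nhds hf]
    with V hV
  exact ⟨_, toReduced_mem_closureCc hV, mem_of_mem_nhds hN⟩

/-- The functions in `C_c(G)` which belong to `P`. -/
noncomputable def ccPart (P : MaxSpace G.ReducedCStarAlgebra) : Submodule ℂ C_c(G₁, ℂ) :=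
  (ClosedSubmodule.toSubmodule P).comap G.toReduced

theorem closureCc_sup (U V : G.OpensSpace) :
    G.closureCc (U ⊔ V) = G.closureCc U ⊔ G.closureCc V := by
  refine le_antisymm (closureCc_le.2 fun f hf => ?_)
    (sup_le (closureCc_mono le_sup_left) (closureCc_mono le_sup_right))
  refine mem_of_locally_mem (ccPart (G.closureCc U ⊔ G.closureCc V)) f fun x hx => ?_
  have h1 : G.closureCc U ≤ G.closureCc U ⊔ G.closureCc V := le_sup_left
  have h2 : G.closureCc V ≤ G.closureCc U ⊔ G.closureCc V := le_sup_right
  rcases OpensSpace.mem_sup.1 (hf hx) with h | h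
  · exact ⟨U, U.isOpen, h, fun g hg => h1 (toReduced_mem_closureCc hg)⟩
  · exact ⟨V, V.isOpen, h, fun g hg => h2 (toReduced_mem_closureCc hg)⟩

theorem closureCc_bot : G.closureCc ⊥ = ⊥ := by
  refine le_bot_iff.1 (closureCc_le.2 fun f hf => ?_)
  have : f = 0 := by
    ext x
    by_contra h0
    exact hf (subset_tsupport f h0)
  rw [this, map_zero]
  exact zero_mem _

theorem closureCc_top : G.closureCc ⊤ = ⊤ := by
  refine top_le_iff.1 fun a _ => ?_
  refine closure_minimal ?_ (MaxSpace.isClosed (G.closureCc ⊤)) (G.denseRange_toReduced a)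
  rintro _ ⟨f, rfl⟩
  exact toReduced_mem_closureCc fun x _ => OpensSpace.mem_top x

theorem closureCc_star_le (U : G.OpensSpace) : G.closureCc (star U) ≤ star (G.closureCc U) := by
  refine closureCc_le.2 fun f hf => ?_
  rw [MaxSpace.mem_star, ← toReduced_starCc]
  refine toReduced_mem_closureCc ?_
  simpa only [OpensSpace.star_star] using G.tsupport_starCc_subset hf

theorem closureCc_star (U : G.OpensSpace) : G.closureCc (star U) = star (G.closureCc U) := by
  refine le_antisymm (closureCc_star_le U) ?_
  have := MaxSpace.star_mono (closureCc_star_le (star U))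
  simpa only [OpensSpace.star_star, MaxSpace.star_star] using this

theorem closureCc_mul_le (U V : G.OpensSpace) :
    G.closureCc U * G.closureCc V ≤ G.closureCc (U * V) := by
  refine MaxSpace.mul_le.2 fun a ha b hb => ?_
  refine MaxSpace.mem_rightDiv.1 (closureCc_le.2 (fun f hf => ?_) ha)
  rw [MaxSpace.mem_rightDiv]
  refine MaxSpace.mem_leftDiv.1 (closureCc_le.2 (fun g hg => ?_) hb)
  rw [MaxSpace.mem_leftDiv, ← toReduced_convCc]
  exact toReduced_mem_closureCc (G.tsupport_convCc_subset hf hg)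

/-- For a cutoff `h` in the bisection `Z` equal to 1 on `C`, associativity gives `(f * h*) * h = f *
(h* * h) = f`. The first factor is supported in `U W Z* ⊆ U Z Z* ⊆ U` and the second in `Z ⊆ V`. -/
theorem toReduced_mem_mul_of_tsupport_subset {U V Z : G.OpensSpace} {C : Set G₁} (hC : IsCompact C)
    (hCZ : C ⊆ Z) (hZV : Z ≤ V) (hd : InjOn G.d Z) (hr : InjOn G.r Z) {W : G.OpensSpace}
    (hW : (W : Set G₁) ⊆ C) {f : C_c(G₁, ℂ)} (hf : tsupport f ⊆ (U * W : G.OpensSpace)) :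
    G.toReduced f ∈ G.closureCc U * G.closureCc V := by
  obtain ⟨h, hh, h1⟩ := exists_cc_eq_one hC Z.isOpen hCZ
  have hWZ : W ≤ Z := fun x hx => hCZ (hW hx)
  -- Convolving with a function supported on units is pointwise multiplication by its value at `u (d
  -- x)`.
  have hk : tsupport (G.convCc (G.starCc h) h) ⊆ OpensSpace.units G := fun x hx =>
    OpensSpace.star_mul_le_units hr
      (G.tsupport_convCc_subset (G.tsupport_starCc_subset hh) hh hx)
  have hF : tsupport (G.convCc f (G.starCc h)) ⊆ U := by
    refine (G.tsupport_convCc_subset hf (G.tsupport_starCc_subset hh)).trans ?_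
    have h2 : U * W * star Z ≤ U := by
      rw [OpensSpace.mul_assoc]
      refine (OpensSpace.mul_mono le_rfl ((OpensSpace.mul_mono hWZ le_rfl).trans
        (OpensSpace.mul_star_le_units hd))).trans ?_
      exact (OpensSpace.isMulUnit_units U).2.le
    exact h2
  have key : G.convCc (G.convCc f (G.starCc h)) h = f := by
    rw [convCc_assoc]
    ext x
    refine (G.conv_eq_mul_of_support_units f (G.convCc (G.starCc h) h)
      (fun z hz => hk (subset_tsupport _ hz)) x).trans ?_
    by_cases hx : x ∈ tsupport f
    -- On the support of `f` the arrow is `y z` with `z ∈ W ⊆ C`, where `h` equals 1, so the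
    -- multiplier is `star 1 * 1 = 1`.
    · obtain ⟨y, -, z, hz, w, rfl⟩ := OpensSpace.mem_mul.1 (hf hx)
      have h3 : G.convCc (G.starCc h) h (G.u (G.d z)) = star (h z) * h z :=
        G.convStar_conv_self_unit ((subset_tsupport h).trans hh) hd (hWZ hz)
      rw [G.d_mul, h3, h1 z (hW hz)]
      simp
    · simp [image_eq_zero_of_notMem_tsupport hx]
  rw [← key, toReduced_convCc]
  exact MaxSpace.mul_mem_mul (toReduced_mem_closureCc hF)
    (toReduced_mem_closureCc fun x hx => hZV (hh hx))

theorem closureCc_mul (U V : G.OpensSpace) :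
    G.closureCc (U * V) = G.closureCc U * G.closureCc V := by
  refine le_antisymm (closureCc_le.2 fun f hf => ?_) (closureCc_mul_le U V)
  refine mem_of_locally_mem (ccPart (G.closureCc U * G.closureCc V)) f fun x hx => ?_
  obtain ⟨y, hy, z, hz, w, rfl⟩ := OpensSpace.mem_mul.1 (hf hx)
  obtain ⟨Z, hZV, hzZ, hd, hr⟩ := OpensSpace.exists_bisection hz
  obtain ⟨C, hC, hzC, hCZ⟩ := exists_compact_subset Z.isOpen hzZ
  let W : G.OpensSpace := ⟨interior C, isOpen_interior⟩
  exact ⟨(U * W : G.OpensSpace), (U * W).isOpen, OpensSpace.mul_mem_mul hy hzC w, fun g hg =>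
    toReduced_mem_mul_of_tsupport_subset hC hCZ hZV hd hr (W := W) interior_subset hg⟩

theorem isMeasurementSpaceHom_closureCc (G : EtaleGroupoid G₀ G₁) :
    IsMeasurementSpaceHom G.closureCc where
  continuous := continuous_closureCc
  map_sup := closureCc_sup
  map_bot := closureCc_bot
  map_mul := closureCc_mul
  map_star := closureCc_star

end ClosureCc

end EtaleGroupoid

/-! ### The convolution formula in the completed algebra -/

theorem lp.continuous_apply {I : Type*} (x : I) :
    Continuous fun ξ : lp (fun _ : I => ℂ) 2 => ξ x :=
  (_root_.continuous_apply x).comp lp.uniformContinuous_coe.continuous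

open Classical in
theorem hasSum_apply_single_mul {I : Type*} (T : lp (fun _ : I => ℂ) 2 →L[ℂ] lp (fun _ : I => ℂ) 2)
    (ξ : lp (fun _ : I => ℂ) 2) (x : I) :
    HasSum (fun z => T (lp.single 2 z 1) x * ξ z) (T ξ x) := by
  have h1 := (lp.hasSum_single (by norm_num) ξ).mapL T
  have h2 := h1.map (⟨⟨fun η : lp (fun _ : I => ℂ) 2 => η x, rfl⟩, fun _ _ => rfl⟩ :
    lp (fun _ : I => ℂ) 2 →+ ℂ) (lp.continuous_apply x)
  convert h2 using 1
  · funext z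
    change _ = T (lp.single 2 z (ξ z)) x
    have h3 : lp.single (E := fun _ : I => ℂ) 2 z (ξ z) = ξ z • lp.single 2 z 1 := by
      rw [← lp.single_smul, smul_eq_mul, mul_one]
    rw [h3, map_smul, lp.coeFn_smul, Pi.smul_apply, smul_eq_mul, mul_comm]
  · rfl

namespace EtaleGroupoid
variable {G₀ G₁ : Type*} [TopologicalSpace G₀] [TopologicalSpace G₁] [T2Space G₁]
  [LocallyCompactSpace G₁]

open scoped CompactlySupported

theorem toFunction_add (G : EtaleGroupoid G₀ G₁) (a b : G.ReducedCStarAlgebra) (x : G₁) :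
    G.toFunction (a + b) x = G.toFunction a x + G.toFunction b x := rfl

theorem norm_toFunction_le (G : EtaleGroupoid G₀ G₁) (a : G.ReducedCStarAlgebra) (x : G₁) :
    ‖G.toFunction a x‖ ≤ ‖a‖ := by
  classical
  refine (lp.norm_apply_le_norm (by norm_num) _ x).trans ?_
  refine (ContinuousLinearMap.le_opNorm _ _).trans ?_
  rw [lp.norm_single (by norm_num)]
  simp

/-- Evaluation at an arrow, as a continuous linear functional on `C_r^*(G)`. -/
noncomputable def evalCLM (G : EtaleGroupoid G₀ G₁) (x : G₁) : G.ReducedCStarAlgebra →L[ℂ] ℂ :=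
  LinearMap.mkContinuous
    { toFun := fun a => G.toFunction a x
      map_add' := fun a b => G.toFunction_add a b x
      map_smul' := fun _ _ => rfl } 1
    fun a => (G.norm_toFunction_le a x).trans (one_mul _).ge

theorem continuous_toFunction_left (G : EtaleGroupoid G₀ G₁) (x : G₁) :
    Continuous fun a : G.ReducedCStarAlgebra => G.toFunction a x :=
  (G.evalCLM x).continuous

/-- Evaluation is bounded by the norm uniformly in the arrow, so the change in `a` is controlled
uniformly and the rest is continuity of one fixed function. Joint continuity is what makes the open
support continuous. -/
theorem continuous_toFunction (G : EtaleGroupoid G₀ G₁) :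
    Continuous fun p : G.ReducedCStarAlgebra × G₁ => G.toFunction p.1 p.2 := by
  refine continuous_iff_continuousAt.2 fun ⟨a, x⟩ => ?_
  have h1 : Filter.Tendsto (fun p : G.ReducedCStarAlgebra × G₁ => G.toFunction (p.1 - a) p.2)
      (𝓝 (a, x)) (𝓝 0) := by
    refine squeeze_zero_norm (fun p => G.norm_toFunction_le _ _) ?_
    have : Continuous fun p : G.ReducedCStarAlgebra × G₁ => ‖p.1 - a‖ := by fun_prop
    simpa using this.tendsto (a, x)
  have h2 : Filter.Tendsto (fun p : G.ReducedCStarAlgebra × G₁ => G.toFunction a p.2)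
      (𝓝 (a, x)) (𝓝 (G.toFunction a x)) :=
    ((G.continuous_evalOp a).comp continuous_snd).tendsto (a, x)
  have h3 := h1.add h2
  rw [zero_add] at h3
  refine h3.congr fun p => ?_
  rw [← toFunction_add, sub_add_cancel]

theorem reduced_induction (G : EtaleGroupoid G₀ G₁) {p : G.ReducedCStarAlgebra → Prop}
    (hp : IsClosed {a | p a}) (h : ∀ f, p (G.toReduced f)) (a : G.ReducedCStarAlgebra) : p a :=
  G.denseRange_toReduced.induction_on a hp h

theorem toFunction_star (G : EtaleGroupoid G₀ G₁) (a : G.ReducedCStarAlgebra) (x : G₁) :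
    G.toFunction (star a) x = star (G.toFunction a (G.inv x)) := by
  refine G.reduced_induction (p := fun a => G.toFunction (star a) x =
    star (G.toFunction a (G.inv x))) ?_ (fun f => ?_) a
  · exact isClosed_eq ((G.continuous_toFunction_left x).comp continuous_star)
      (G.continuous_toFunction_left _).star
  · rw [← toReduced_starCc, toFunction_toReduced, toFunction_toReduced]
    rfl

open Classical in
-- Both sides are continuous in `a` and agree on the dense image of `C_c(G)`. So every element of
-- the completion is the matrix of left convolution by its own function.
theorem apply_single (G : EtaleGroupoid G₀ G₁) (a : G.ReducedCStarAlgebra) (h x : G₁) :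
    (a : lp (fun _ : G₁ => ℂ) 2 →L[ℂ] lp (fun _ : G₁ => ℂ) 2) (lp.single 2 h 1) x =
      G.kernel (G.toFunction a) x h := by
  refine G.reduced_induction (p := fun a : G.ReducedCStarAlgebra =>
    (a : lp (fun _ : G₁ => ℂ) 2 →L[ℂ] lp (fun _ : G₁ => ℂ) 2) (lp.single 2 h 1) x =
      G.kernel (G.toFunction a) x h) ?_ (fun f => ?_) a
  · refine isClosed_eq ((lp.continuous_apply x).comp ?_) ?_
    · exact (ContinuousLinearMap.apply ℂ _ (lp.single (E := fun _ : G₁ => ℂ) 2 h 1)).continuous.comp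
        continuous_subtype_val
    · unfold TopologicalGroupoid.kernel
      split_ifs with hx
      · exact G.continuous_toFunction_left _
      · exact continuous_const
  · rw [toFunction_toReduced]
    exact G.regRep_single f h x

/-- Expand the vector `b δ_{u(d x)}` in the standard basis and apply the matrix of `a`. The sum over
factorizations of `x` converges, though it need no longer be finite. -/
theorem hasSum_toFunction_mul (G : EtaleGroupoid G₀ G₁) (a b : G.ReducedCStarAlgebra) (x : G₁) :
    HasSum (fun z => G.kernel (G.toFunction a) x z * G.kernel (G.toFunction b) z (G.u (G.d x)))
      (G.toFunction (a * b) x) := by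
  classical
  simp only [← apply_single]
  exact hasSum_apply_single_mul _ _ x

theorem exists_of_toFunction_mul_ne_zero (G : EtaleGroupoid G₀ G₁) {a b : G.ReducedCStarAlgebra}
    {x : G₁} (h : G.toFunction (a * b) x ≠ 0) :
    ∃ y z, ∃ w : G.d y = G.r z, G.mul y z w = x ∧ G.toFunction a y ≠ 0 ∧ G.toFunction b z ≠ 0 := by
  obtain ⟨z, hz⟩ : ∃ z, G.kernel (G.toFunction a) x z *
      G.kernel (G.toFunction b) z (G.u (G.d x)) ≠ 0 := by
    by_contra! h0
    have := G.hasSum_toFunction_mul a b x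
    simp only [h0] at this
    exact h (this.unique hasSum_zero)
  obtain ⟨hzx, hb⟩ := G.kernel_unit_ne_zero (right_ne_zero_of_mul hz)
  have ha := left_ne_zero_of_mul hz
  rw [TopologicalGroupoid.kernel, dif_pos hzx.symm] at ha
  exact ⟨_, z, by rw [G.d_mul, G.d_inv], G.inv_mul_cancel_right x z hzx.symm, ha, hb⟩

/-- In a factorization of `y z`, the second factor has the domain of `z`; injectivity of `d` on `S`
leaves one nonzero term at most, so nothing can cancel. -/
theorem toFunction_mul_of_injOn (G : EtaleGroupoid G₀ G₁) (a : G.ReducedCStarAlgebra)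
    {b : G.ReducedCStarAlgebra} {S : Set G₁} (hb : support (G.toFunction b) ⊆ S)
    (hS : InjOn G.d S) {y z : G₁} (hz : z ∈ S) (w : G.d y = G.r z) :
    G.toFunction (a * b) (G.mul y z w) = G.toFunction a y * G.toFunction b z := by
  have h1 := G.hasSum_toFunction_mul a b (G.mul y z w)
  have h2 := h1.unique (hasSum_single z fun z' hz' => ?_)
  · rw [h2, G.d_mul, G.kernel_unit]
    congr 1
    rw [TopologicalGroupoid.kernel, dif_pos (G.d_mul y z w), G.mul_inv_cancel_right]
  · by_contra h0
    obtain ⟨h3, h4⟩ := G.kernel_unit_ne_zero (right_ne_zero_of_mul h0)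
    rw [G.d_mul] at h3
    exact hz' (hS (hb h4) hz h3)

/-! ### The open support as retraction -/

section OpenSupport

variable {G : EtaleGroupoid G₀ G₁}

theorem mem_openSupport {P : MaxSpace G.ReducedCStarAlgebra} {x : G₁} :
    x ∈ G.openSupport P ↔ ∃ a ∈ P, G.toFunction a x ≠ 0 :=
  mem_iUnion₂.trans (by simp only [mem_support, exists_prop])

/-- The elements of `C_r^*(G)` which vanish outside of `U`. -/
noncomputable def supportedIn (U : G.OpensSpace) : MaxSpace G.ReducedCStarAlgebra :=
  (⨅ (x : G₁) (_ : x ∉ U), ClosedSubmodule.comap (G.evalCLM x) ⊥ :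
    ClosedSubmodule ℂ G.ReducedCStarAlgebra)

theorem mem_supportedIn {U : G.OpensSpace} {a : G.ReducedCStarAlgebra} :
    a ∈ supportedIn U ↔ support (G.toFunction a) ⊆ U := by
  have : a ∈ supportedIn U ↔ ∀ x, x ∉ U → G.toFunction a x = 0 := by
    refine ClosedSubmodule.mem_iInf.trans (forall_congr' fun x => ?_)
    exact ClosedSubmodule.mem_iInf.trans Iff.rfl
  rw [this]
  exact ⟨fun h x hx => by_contra fun h' => hx (h x h'), fun h x hx => by_contra fun h' => hx (h h')⟩

/-- As a left adjoint the open support preserves joins and bottom. Upper bounds on the open support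
of a closed span become inclusions into a closed subspace, tested on generators. -/
theorem gc_openSupport_supportedIn : GaloisConnection G.openSupport supportedIn := by
  refine fun P U => ⟨fun h a ha => mem_supportedIn.2 fun x hx => h (mem_openSupport.2 ⟨a, ha, hx⟩),
    fun h x hx => ?_⟩
  obtain ⟨a, ha, hax⟩ := mem_openSupport.1 hx
  exact mem_supportedIn.1 (h ha) hax

theorem continuous_openSupport : Continuous G.openSupport := by
  refine OpensSpace.continuous_iff_isOpen.2 (isOpen_iff_mem_nhds.2 fun ⟨P, x⟩ hx => ?_)
  obtain ⟨a, ha, hax⟩ := mem_openSupport.1 hx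
  have h1 := (isOpen_ne_fun G.continuous_toFunction (continuous_const (y := (0 : ℂ)))).mem_nhds
    (show (a, x) ∈ _ from hax)
  rw [nhds_prod_eq] at h1
  obtain ⟨V, hV, W, hW, h⟩ := Filter.mem_prod_iff.1 h1
  filter_upwards [prod_mem_nhds (MaxSpace.eventually_inter_nonempty ha hV) hW]
  rintro ⟨Q, y⟩ ⟨⟨b, hbQ, hbV⟩, hy⟩
  exact mem_openSupport.2 ⟨b, hbQ, h (mk_mem_prod hbV hy)⟩

theorem openSupport_star (P : MaxSpace G.ReducedCStarAlgebra) :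
    G.openSupport (star P) = star (G.openSupport P) := by
  refine SetLike.ext fun x => ?_
  rw [OpensSpace.mem_star, mem_openSupport, mem_openSupport]
  constructor
  · rintro ⟨a, ha, hx⟩
    refine ⟨star a, ha, ?_⟩
    rwa [toFunction_star, G.inv_inv, star_ne_zero]
  · rintro ⟨a, ha, hx⟩
    refine ⟨star a, MaxSpace.star_mem_star ha, ?_⟩
    rwa [toFunction_star, star_ne_zero]

theorem openSupport_mul_le (P Q : MaxSpace G.ReducedCStarAlgebra) :
    G.openSupport (P * Q) ≤ G.openSupport P * G.openSupport Q := by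
  refine gc_openSupport_supportedIn.l_le (MaxSpace.mul_le.2 fun a ha b hb => ?_)
  refine mem_supportedIn.2 fun x hx => ?_
  obtain ⟨y, z, w, rfl, hy, hz⟩ := G.exists_of_toFunction_mul_ne_zero hx
  exact OpensSpace.mul_mem_mul (mem_openSupport.2 ⟨a, ha, hy⟩) (mem_openSupport.2 ⟨b, hb, hz⟩) w

/-- The bump lives in a bisection, so right multiplication by it translates values without
cancellation. -/
theorem exists_bump {U : G.OpensSpace} {x : G₁} (hx : x ∈ U) :
    ∃ h : C_c(G₁, ℂ), G.toReduced h ∈ G.closureCc U ∧ h x = 1 ∧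
      ∃ S : Set G₁, x ∈ S ∧ support h ⊆ S ∧ InjOn G.d S := by
  obtain ⟨V, hVU, hxV, hd, -⟩ := OpensSpace.exists_bisection hx
  obtain ⟨h, hh, h1⟩ := exists_cc_eq_one isCompact_singleton V.isOpen (singleton_subset_iff.2 hxV)
  exact ⟨h, toReduced_mem_closureCc fun y hy => hVU (hh hy), h1 x rfl, V, hxV,
    (subset_tsupport h).trans hh, hd⟩

theorem openSupport_closureCc (U : G.OpensSpace) : G.openSupport (G.closureCc U) = U := by
  refine le_antisymm (gc_openSupport_supportedIn.l_le (closureCc_le.2 fun f hf => ?_))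
    fun x hx => ?_
  · rw [mem_supportedIn, toFunction_toReduced]
    exact (subset_tsupport f).trans hf
  · obtain ⟨h, hU, h1, -⟩ := exists_bump hx
    refine mem_openSupport.2 ⟨_, hU, ?_⟩
    rw [toFunction_toReduced, h1]
    exact one_ne_zero

theorem exists_toFunction_mul_ne_zero {P : MaxSpace G.ReducedCStarAlgebra} {U : G.OpensSpace}
    {y z : G₁} (hy : y ∈ G.openSupport P) (hz : z ∈ U) (w : G.d y = G.r z) :
    ∃ a ∈ P * G.closureCc U, G.toFunction a (G.mul y z w) ≠ 0 := by
  obtain ⟨a, ha, hay⟩ := mem_openSupport.1 hy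
  obtain ⟨h, hU, h1, S, hzS, hS, hd⟩ := exists_bump hz
  refine ⟨_, MaxSpace.mul_mem_mul ha hU, ?_⟩
  rw [← G.toFunction_toReduced h] at hS
  rw [G.toFunction_mul_of_injOn a hS hd hzS w, toFunction_toReduced, h1, mul_one]
  exact hay

theorem openSupport_mul_closureCc (P : MaxSpace G.ReducedCStarAlgebra) (U : G.OpensSpace) :
    G.openSupport (P * G.closureCc U) = G.openSupport P * U := by
  refine le_antisymm ?_ fun x hx => ?_
  · simpa only [openSupport_closureCc] using openSupport_mul_le P (G.closureCc U)
  · obtain ⟨y, hy, z, hz, w, rfl⟩ := OpensSpace.mem_mul.1 hx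
    exact mem_openSupport.2 (exists_toFunction_mul_ne_zero hy hz w)

/-- The middle factor is absorbed into the first by `openSupport_mul_closureCc`. Then elements `a`
and `b` nonzero at `y` and `z` have a product nonzero at `y z`, since `b` is supported where `d` is
injective. -/
theorem mul_mul_openSupport_le (U : G.OpensSpace) (P Q : MaxSpace G.ReducedCStarAlgebra)
    (hQ : InjOn G.d (G.openSupport Q)) :
    G.openSupport P * U * G.openSupport Q ≤ G.openSupport (P * G.closureCc U * Q) := by
  intro x hx
  obtain ⟨y, hy, z, hz, w, rfl⟩ := OpensSpace.mem_mul.1 hx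
  rw [← openSupport_mul_closureCc] at hy
  obtain ⟨a, ha, hay⟩ := mem_openSupport.1 hy
  obtain ⟨b, hb, hbz⟩ := mem_openSupport.1 hz
  refine mem_openSupport.2 ⟨a * b, MaxSpace.mul_mem_mul ha hb, ?_⟩
  rw [G.toFunction_mul_of_injOn a (fun t ht => mem_openSupport.2 ⟨b, hb, ht⟩) hQ hz w]
  exact mul_ne_zero hay hbz

theorem isObserverMap (G : EtaleGroupoid G₀ G₁) : IsObserverMap G.closureCc G.openSupport where
  isMeasurementSpace_source := MaxSpace.isMeasurementSpace _
  isMeasurementSpace_target := OpensSpace.isMeasurementSpace G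
  isMeasurementSpaceHom := isMeasurementSpaceHom_closureCc G
  isSoberLatticeHom :=
    { continuous := continuous_openSupport
      map_sup := fun _ _ => gc_openSupport_supportedIn.l_sup
      map_bot := gc_openSupport_supportedIn.l_bot }
  retraction := openSupport_closureCc
  map_star := openSupport_star
  map_mul_embedding := openSupport_mul_closureCc

theorem isEtaleObserver [SecondCountableTopology G₁] (G : EtaleGroupoid G₀ G₁) :
    IsEtaleObserver G.closureCc G.openSupport where
  toIsObserverMap := isObserverMap G
  isClassical := OpensSpace.isClassicalMeasurementSpace G
  isInverseQuantalFrame := OpensSpace.isInverseQuantalFrame G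
  mul_mul_le := fun U P Q _ hQ =>
    mul_mul_openSupport_le U P Q (OpensSpace.injOn_d_of_mem_partialUnits hQ)

end OpenSupport

end EtaleGroupoid

theorem mainTheorem1 {G₀ G₁ : Type*} [TopologicalSpace G₀] [TopologicalSpace G₁] [T2Space G₁]
    [LocallyCompactSpace G₁] [SecondCountableTopology G₁] (G : EtaleGroupoid G₀ G₁) :
    IsObserverMap (M := MaxSpace G.ReducedCStarAlgebra) (O := G.OpensSpace)
        G.closureCc G.openSupport ∧
      IsEtaleObserver G.closureCc G.openSupport ∧
      IsFullObserver G.closureCc ∧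
      IsMultiplicativeObserver G.openSupport :=
  ⟨G.isObserverMap, G.isEtaleObserver, EtaleGroupoid.closureCc_top,
    EtaleGroupoid.openSupport_mul_le⟩
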